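/- Let $n\ge 2$ be an integer and let $\varepsilon>0$, $N\ge n$, $\eta\le 1$ and $\lambda$ be real numbers. Consider the metric horn: $\mathbb R^n$ with tip $0$, $r=|x|$, the metric $g=dr^2+(\tfrac12 r^{1+\varepsilon})^2g_{S^{n-1}}$ on $\mathbb R^n\setminus\{0\}$, and the weighted measure $\mathfrak m=r^{(N-n)(1-\eta)}\,d\mathrm{vol}_g$; let $\mathfrak m_r=r^{(N-n)(1-\eta)}\,d\mathrm{vol}_{\partial B_r}$ be the weighted area measure on $\partial B_r=\{|x|=r\}$, where $B_r=\{|x|<r\}$, and let $\Delta$ be the weighted Laplacian. An eigenfunction on $B_R$ is a function $u$ which is $C^2$ on $B_R\setminus\{0\}$, satisfies $\Delta u=\lambda u$ there, and has $\int_{B_r}(u^2+|\nabla u|^2)\,d\mathfrak m<\infty$ for every $r<R$; the case $\lambda=0$ is that of harmonic functions. Put $$I(r)=r^{1-n}\int_{\partial B_r}u^2\,d\mathfrak m_r,\qquad E(r)=r^{2-n}\int_{B_r}\big(|\nabla u|^2+\lambda u^2\big)\,d\mathfrak m,\qquad U(r)=\frac{E(r)}{I(r)}.$$ (i) There is $r_0\in(0,1]$,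 depending only on $n,\varepsilon,N,\eta,\lambda$, with $r_0=1$ if $\lambda\ge 0$, such that for every $\rho\in(0,r_0]$ and every $\Lambda\in\mathbb R$ there is a constant $C>0$, depending only on $n,\varepsilon,N,\eta,\lambda,\rho,\Lambda$, with the following property. If $R>\rho$ and $u$ is an eigenfunction on $B_R$ which is not identically zero on $B_R\setminus\{0\}$ and has $U(\rho)\le\Lambda$, then for all $0<r\le\rho$ $$I(r)>0,\qquad U(r)\le C\,r^{-2\varepsilon},\qquad I(r)\ge C^{-1}I(\rho)\,e^{-C r^{-2\varepsilon}}.$$ (ii) Let $R>0$ and let $u$ be an eigenfunction on $B_R$. If $u(x)=O(e^{-C|x|^{-2\varepsilon}})$ as $x\to 0$ for some $C>0$, then $u\equiv 0$ on $B_R\setminus\{0\}$. -/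

import Mathlib

open MeasureTheory Asymptotics Filter Topology

noncomputable section

namespace MetricHorn

/-- The underlying space `ℝⁿ` of the horn; the tip is `0`, and `‖x‖` is the radial coordinate `r`,
which is the distance of `x` to the tip in the horn metric. -/
abbrev E (n : ℕ) := EuclideanSpace ℝ (Fin n)

/-- The warping function `f(r) = ½ r^{1+ε}`. -/
def warp (ε r : ℝ) : ℝ := 1 / 2 * r ^ (1 + ε)

/-- The angular coordinate `x ↦ x / |x|`. -/
def angle {n : ℕ} (x : E n) : E n := ‖x‖⁻¹ • x

/-- The Riemannian metric `g = dr² + f(r)² g_{S^{n-1}}` on `ℝⁿ ∖ {0}`, where `g_{S^{n-1}}` is the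
round metric, pulled back along `x ↦ x / |x|`. -/
def metric {n : ℕ} (ε : ℝ) (x v w : E n) : ℝ :=
  fderiv ℝ (fun y : E n => ‖y‖) x v * fderiv ℝ (fun y : E n => ‖y‖) x w +
    warp ε ‖x‖ ^ 2 * inner ℝ (fderiv ℝ angle x v) (fderiv ℝ angle x w)

/-- The Riemannian volume density `√ det (g_{ij})` in the Cartesian coordinates. -/
def volDensity (n : ℕ) (ε : ℝ) (x : E n) : ℝ :=
  √(Matrix.det (Matrix.of fun i j : Fin n =>
    metric ε x (EuclideanSpace.single i 1) (EuclideanSpace.single j 1)))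

/-- The weight `e^{-ψ(r)} = r^{(N-n)(1-η)}`. -/
def weight (n : ℕ) (N η r : ℝ) : ℝ := r ^ ((N - n) * (1 - η))

/-- The density of the weighted volume measure with respect to Lebesgue measure. -/
def density (n : ℕ) (ε N η : ℝ) (x : E n) : ℝ := weight n N η ‖x‖ * volDensity n ε x

/-- The weighted volume measure of the metric horn. -/
def hornMeasure (n : ℕ) (ε N η : ℝ) : Measure (E n) :=
  (volume : Measure (E n)).withDensity fun x => ENNReal.ofReal (density n ε N η x)

/-- The weighted area measure on the level set `{r = const}`, which is the unit sphere with the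
metric `f(r)² g_{S^{n-1}}`. -/
def hornArea (n : ℕ) (ε N η r : ℝ) : Measure (E n) :=
  ENNReal.ofReal (weight n N η r * warp ε r ^ (n - 1)) •
    Measure.map (fun ω : Metric.sphere (0 : E n) 1 => r • (ω : E n)) (volume : Measure (E n)).toSphere

/-- The Riemannian gradient of `u` for the metric `g`: the radial part of the Euclidean gradient is
unchanged, and the angular part is scaled by `(r / f(r))²` (see `metric_grad`). -/
def grad {n : ℕ} (ε : ℝ) (u : E n → ℝ) (x : E n) : E n :=
  inner ℝ (angle x) (gradient u x) • angle x +
    (‖x‖ / warp ε ‖x‖) ^ 2 •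
      (gradient u x - inner ℝ (angle x) (gradient u x) • angle x)

/-- `|∇u|²` in the horn metric. -/
def gradSq {n : ℕ} (ε : ℝ) (u : E n → ℝ) (x : E n) : ℝ :=
  metric ε x (grad ε u x) (grad ε u x)

/-- The Euclidean divergence of a vector field. -/
def div {n : ℕ} (F : E n → E n) (x : E n) : ℝ :=
  ∑ i : Fin n, fderiv ℝ F x (EuclideanSpace.single i 1) i

/-- The weighted Laplacian `Δu = ρ⁻¹ ∂ᵢ(ρ g^{ij} ∂ⱼu)`, with `ρ` the density of the weighted
volume measure. -/
def laplacian {n : ℕ} (ε N η : ℝ) (u : E n → ℝ) (x : E n) : ℝ :=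
  (density n ε N η x)⁻¹ * div (fun y => density n ε N η y • grad ε u y) x

/-- `u` is an eigenfunction, `Δu = lam • u`, on the ball `B_R` around the tip: it is `C²` and solves
the equation away from the tip, and it belongs to `W^{1,2}(B_r)` for every `r < R`. -/
structure IsEigenfunction {n : ℕ} (ε N η lam R : ℝ) (u : E n → ℝ) : Prop where
  contDiffOn : ContDiffOn ℝ 2 u (Metric.ball 0 R \ {0})
  eq : ∀ x ∈ Metric.ball (0 : E n) R \ {0}, laplacian ε N η u x = lam * u x
  energy : ∀ r < R, IntegrableOn (fun x => u x ^ 2 + gradSq ε u x)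
    (Metric.ball 0 r) (hornMeasure n ε N η)

/-- `I(r) = r^{1-n} ∫_{∂B_r} u²`. -/
def freqI {n : ℕ} (ε N η : ℝ) (u : E n → ℝ) (r : ℝ) : ℝ :=
  r ^ (1 - (n : ℝ)) * ∫ x, u x ^ 2 ∂(hornArea n ε N η r)

/-- `E(r) = r^{2-n} ∫_{B_r} |∇u|² + lam u²`. -/
def freqE {n : ℕ} (ε N η lam : ℝ) (u : E n → ℝ) (r : ℝ) : ℝ :=
  r ^ (2 - (n : ℝ)) *
    ∫ x in Metric.ball 0 r, (gradSq ε u x + lam * u x ^ 2) ∂(hornMeasure n ε N η)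

/-- The frequency `U(r) = E(r) / I(r)`. -/
def freqU {n : ℕ} (ε N η lam : ℝ) (u : E n → ℝ) (r : ℝ) : ℝ :=
  freqE ε N η lam u r / freqI ε N η u r

/-! Checks of the explicit formulas. -/

theorem fderiv_norm {n : ℕ} {x : E n} (hx : x ≠ 0) (v : E n) :
    fderiv ℝ (fun y : E n => ‖y‖) x v = inner ℝ (angle x) v := by
  have h1 : HasFDerivAt (fun y : E n => ‖y‖ ^ 2) (2 • (innerSL ℝ x)) x :=
    (hasStrictFDerivAt_norm_sq x).hasFDerivAt
  have h2 : DifferentiableAt ℝ (fun y : E n => ‖y‖) x :=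
    (contDiffAt_norm ℝ hx (n := 1)).differentiableAt (by simp)
  have h3 := (h2.hasFDerivAt.pow 2).unique h1
  have h4 := congrArg (fun L => L v) h3
  simp at h4
  have hn : ‖x‖ ≠ 0 := norm_ne_zero_iff.mpr hx
  rw [angle, real_inner_smul_left, inv_mul_eq_div, eq_div_iff hn]
  linarith

theorem fderiv_angle {n : ℕ} {x : E n} (hx : x ≠ 0) (v : E n) :
    fderiv ℝ (angle : E n → E n) x v = ‖x‖⁻¹ • (v - inner ℝ (angle x) v • angle x) := by
  have hn : ‖x‖ ≠ 0 := norm_ne_zero_iff.mpr hx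
  have h2 : DifferentiableAt ℝ (fun y : E n => ‖y‖) x :=
    (contDiffAt_norm ℝ hx (n := 1)).differentiableAt (by simp)
  have h3 := ((hasDerivAt_inv hn).comp_hasFDerivAt x h2.hasFDerivAt).smul (hasFDerivAt_id x)
  have h4 : fderiv ℝ (angle : E n → E n) x = _ := h3.fderiv
  rw [h4]
  simp [fderiv_norm hx, angle, smul_smul, smul_sub, real_inner_smul_left]
  rw [sub_eq_add_neg, ← neg_smul]
  congr 1
  rw [← neg_smul]
  congr 1
  field_simp

theorem norm_angle {n : ℕ} {x : E n} (hx : x ≠ 0) : inner ℝ (angle x) (angle x) = (1 : ℝ) := by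
  have hn : ‖x‖ ≠ 0 := norm_ne_zero_iff.mpr hx
  rw [angle, real_inner_smul_left, real_inner_smul_right, real_inner_self_eq_norm_sq]
  field_simp

theorem metric_eq {n : ℕ} (ε : ℝ) {x : E n} (hx : x ≠ 0) (v w : E n) :
    metric ε x v w = inner ℝ (angle x) v * inner ℝ (angle x) w + (warp ε ‖x‖ / ‖x‖) ^ 2 *
      (inner ℝ v w - inner ℝ (angle x) v * inner ℝ (angle x) w) := by
  have hn : ‖x‖ ≠ 0 := norm_ne_zero_iff.mpr hx
  rw [metric, fderiv_norm hx, fderiv_norm hx, fderiv_angle hx, fderiv_angle hx]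
  simp only [real_inner_smul_left, real_inner_smul_right, inner_sub_left, inner_sub_right,
    norm_angle hx, real_inner_comm (angle x) v]
  field_simp
  ring

/-- `grad` is the Riemannian gradient: `g(∇u, v) = du(v)`. -/
theorem metric_grad {n : ℕ} (ε : ℝ) (u : E n → ℝ) {x : E n} (hx : x ≠ 0) (v : E n) :
    metric ε x (grad ε u x) v = fderiv ℝ u x v := by
  have hn : 0 < ‖x‖ := norm_pos_iff.mpr hx
  have hw : warp ε ‖x‖ ≠ 0 := by unfold warp; positivity
  rw [metric_eq ε hx, ← inner_gradient_left, grad]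
  simp only [real_inner_smul_left, real_inner_smul_right, inner_sub_left, inner_sub_right,
    inner_add_left, inner_add_right, norm_angle hx]
  field_simp
  ring

theorem volDensity_eq {n : ℕ} (hn1 : 1 ≤ n) (ε : ℝ) {x : E n} (hx : x ≠ 0) :
    volDensity n ε x = (warp ε ‖x‖ / ‖x‖) ^ (n - 1) := by
  have hn : 0 < ‖x‖ := norm_pos_iff.mpr hx
  have hw : 0 < warp ε ‖x‖ := by unfold warp; positivity
  set A := warp ε ‖x‖ / ‖x‖ with hA
  have hA0 : 0 < A := by positivity
  have hM : (Matrix.of fun i j : Fin n =>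
      metric ε x (EuclideanSpace.single i 1) (EuclideanSpace.single j 1)) =
      (A ^ 2) • (1 + Matrix.replicateCol Unit (fun i => (A ^ 2)⁻¹ * (1 - A ^ 2) * angle x i) *
        Matrix.replicateRow Unit (fun i => angle x i)) := by
    ext i j
    simp only [Matrix.of_apply, metric_eq ε hx, Matrix.smul_apply, Matrix.add_apply,
      Matrix.mul_apply, Matrix.replicateCol_apply, Matrix.replicateRow_apply, Matrix.one_apply]
    rw [← hA]
    simp [EuclideanSpace.inner_single_right]
    by_cases h : i = j
    · subst h; simp; field_simp; ring
    · simp [h, Ne.symm h]; field_simp; ring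
  have hs : ∑ i, angle x i * angle x i = 1 := by
    have := norm_angle hx
    rw [PiLp.inner_apply] at this
    simpa [← sq] using this
  have hd : (fun i => angle x i) ⬝ᵥ (fun i => (A ^ 2)⁻¹ * (1 - A ^ 2) * angle x i) =
      (A ^ 2)⁻¹ * (1 - A ^ 2) := by
    have : ∀ i, angle x i * ((A ^ 2)⁻¹ * (1 - A ^ 2) * angle x i) =
      ((A ^ 2)⁻¹ * (1 - A ^ 2)) * (angle x i * angle x i) := fun i => by ring
    simp only [dotProduct, this, ← Finset.mul_sum, hs, mul_one]
  rw [volDensity, hM, Matrix.det_smul, Matrix.det_one_add_replicateCol_mul_replicateRow, hd,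
    Fintype.card_fin]
  obtain ⟨m, rfl⟩ : ∃ m, n = m + 1 := ⟨n - 1, by omega⟩
  have : (A ^ 2) ^ (m + 1) * (1 + (A ^ 2)⁻¹ * (1 - A ^ 2)) = (A ^ m) ^ 2 := by
    field_simp; ring
  rw [this, Real.sqrt_sq (by positivity)]
  simp

end MetricHorn

end

/-!
Integrating over the spheres `∂B_r` turns an eigenfunction `u` on the horn into a one-dimensional
system. With `dω` the measure of the unit sphere and `α = (N - n)(1 - η) + (n - 1)(1 + ε)`, the
weighted volume is a constant times `r^α dr dω`, and the functions `J = ∫ u² dω`, `G = ∫ u uᵣ dω`,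
`P = ∫ uᵣ² dω`, `Q = ∫ (|∇u|² - uᵣ²) dω` of `r` satisfy `J' = 2G` and
* `(r^α G)' = r^α (P + Q + λJ)`, Green's formula;
* `(r^{α+1} (P - Q - λJ))' = r^α ((1 - α) P + (1 + 2ε - α) Q - (α + 1) λ J)`, the
  Rellich-Pohozaev identity.
Both are instances of the divergence theorem on spheres, `hasDerivAt_flux`, for the fields
`u ∇u` and `(x·∇u) ∇u - ½ (|∇u|² + λu²) x` times the density. The divergence theorem itself comes
from polar coordinates and the fact that the divergence of a compactly supported field has integral
zero. `RadialSystem` collects these facts, and `IsEigenfunction.radialSystem` provides them; the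
rest is about this system.

Since `α > 1`, the tip has zero capacity: finite energy and a Hardy inequality show that the boundary
terms at `0` vanish, so both identities hold on balls (`RadialSystem.green`,
`RadialSystem.pohozaev`). The frequency is `U = r G / J`. The Cauchy-Schwarz inequality `G² ≤ P J`
and the two identities give (`RadialSystem.hasDerivAt_normFreq`)
`(r^{2ε} U)' ≥ ε r^{2ε - α} J⁻¹ ∫₀^r t^α P dt - c r^{2ε + 1}`,
where `c = 0` if `λ ≥ 0`, and for `λ < 0` the radius has to be small enough for the Hardy inequality
`RadialSystem.hardy` to absorb the zeroth order term. Thus `r^{2ε} U` is almost monotone, which is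
the upper bound of `U`; integrating `(log J)' = 2U / r` gives the lower bound of `J`. The same
inequality on narrow annuli around a ball on which `u` vanishes bounds `U` from above there, so that
`u` vanishes on a larger ball; hence `J > 0` for a nonzero `u`.

For the strong unique continuation the exponent in the lower bound of `J` has to be arbitrarily small.
This uses the gain `∫ t^α P`: if `r^{2ε} U` stayed above some `L > 0`, then
`∫₀^r t^α P dt ≥ (L/4) r^{α - 1 - 2ε} J` near the tip, so that `(r^{2ε} U)'` would be bounded below by a
positive multiple of `1 / r`, which is impossible (`RadialSystem.eventually_normFreq_le`). So
`r^{2ε} U` is eventually smaller than any positive number, and `J` cannot decay like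
`exp (-c r^{-2ε})` for any `c > 0`.
-/

namespace MetricHorn

open Set

/-! ### Primitives on an interval with a singular left end point -/

theorem monotoneOn_of_hasDerivAt_nonneg {D : Set ℝ} (hD : Convex ℝ D) {f f' : ℝ → ℝ}
    (hf : ∀ x ∈ D, HasDerivAt f (f' x) x) (hf' : ∀ x ∈ D, 0 ≤ f' x) : MonotoneOn f D :=
  monotoneOn_of_hasDerivWithinAt_nonneg hD
    (fun x hx => (hf x hx).continuousAt.continuousWithinAt)
    (fun x hx => (hf x (interior_subset hx)).hasDerivWithinAt)
    fun x hx => hf' x (interior_subset hx)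

theorem hasDerivAt_primitive {h : ℝ → ℝ} {R r : ℝ} (hc : ContinuousOn h (Ioo 0 R))
    (hi : IntervalIntegrable h volume 0 r) (hr : r ∈ Ioo 0 R) :
    HasDerivAt (fun x => ∫ t in (0 : ℝ)..x, h t) (h r) r :=
  intervalIntegral.integral_hasDerivAt_right hi
    (hc.stronglyMeasurableAtFilter isOpen_Ioo r hr) (hc.continuousAt (isOpen_Ioo.mem_nhds hr))

theorem tendsto_primitive {h : ℝ → ℝ} {b s : ℝ} (hi : IntervalIntegrable h volume 0 b)
    (hs : 0 ≤ s) (hsb : s < b) :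
    Tendsto (fun x => ∫ t in (0 : ℝ)..x, h t) (𝓝[>] s) (𝓝 (∫ t in (0 : ℝ)..s, h t)) := by
  have h0b : 0 ≤ b := hs.trans hsb.le
  have hi' : IntegrableOn h (uIcc 0 b) := by
    rw [uIcc_of_le h0b, integrableOn_Icc_iff_integrableOn_Ioc]
    exact (intervalIntegrable_iff_integrableOn_Ioc_of_le h0b).1 hi
  have h1 := intervalIntegral.continuousOn_primitive_interval hi' s
    (by rw [uIcc_of_le h0b]; exact ⟨hs, hsb.le⟩)
  refine h1.mono_left ?_
  rw [uIcc_of_le h0b, ← nhdsWithin_Ioo_eq_nhdsGT hsb]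
  exact nhdsWithin_mono _ fun x hx => ⟨hs.trans hx.1.le, hx.2.le⟩

/-- A nonnegative function with bounded integrals over `(s, r)`, `s → 0`, is integrable up to
`0`. -/
theorem intervalIntegrable_of_bounded {h : ℝ → ℝ} {r M : ℝ} (hr : 0 < r)
    (hc : ContinuousOn h (Ioc 0 r)) (h0 : ∀ t ∈ Ioc 0 r, 0 ≤ h t)
    (hM : ∀ s ∈ Ioo 0 r, ∫ t in s..r, h t ≤ M) : IntervalIntegrable h volume 0 r := by
  rw [intervalIntegrable_iff_integrableOn_Ioc_of_le hr.le]
  have hpos : ∀ i : ℕ, 0 < r / ((i : ℝ) + 1) := fun i => by positivity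
  refine integrableOn_Ioc_of_intervalIntegral_norm_bounded_left (l := atTop)
    (a := fun i : ℕ => r / ((i : ℝ) + 1)) (I := M) (fun i => ?_) ?_ ?_
  · have : IntegrableOn h (Icc (r / ((i : ℝ) + 1)) r) :=
      (hc.mono fun x hx => ⟨(hpos i).trans_le hx.1, hx.2⟩).integrableOn_Icc
    exact this.mono_set Ioc_subset_Icc_self
  · exact tendsto_const_div_atTop_nhds_zero_nat r |>.comp (tendsto_add_atTop_nat 1) |>.congr
      fun i => by simp
  · filter_upwards [eventually_gt_atTop 0] with i hi
    have hi' : r / ((i : ℝ) + 1) < r := by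
      apply div_lt_self hr
      have : (0 : ℝ) < i := by exact_mod_cast hi
      linarith
    refine le_trans (le_of_eq ?_) (hM _ ⟨hpos i, hi'⟩)
    rw [intervalIntegral.integral_of_le hi'.le]
    refine setIntegral_congr_fun measurableSet_Ioc fun t ht => ?_
    exact abs_of_nonneg (h0 t ⟨(hpos i).trans ht.1, ht.2⟩)

/-- If `φ'` and `φ(t) / t` are integrable near `0`, then `φ` vanishes at `0`, because `1 / t` is
not integrable; so `φ` is the primitive of `φ'` from `0`. -/
theorem eq_primitive_of_integrable_div {φ φ' : ℝ → ℝ} {R r : ℝ}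
    (hd : ∀ t ∈ Ioo 0 R, HasDerivAt φ (φ' t) t) (hr : r ∈ Ioo 0 R)
    (hi : IntervalIntegrable φ' volume 0 r)
    (hdiv : IntervalIntegrable (fun t => φ t / t) volume 0 r) :
    φ r = ∫ t in (0 : ℝ)..r, φ' t := by
  -- `c` is the limit of `φ` at `0`
  set c := φ r - ∫ t in (0 : ℝ)..r, φ' t with hc
  have hsub : ∀ t ∈ Ioc 0 r, IntervalIntegrable φ' volume 0 t := fun t ht =>
    hi.mono_set (by rw [uIcc_of_le ht.1.le, uIcc_of_le hr.1.le]; exact Icc_subset_Icc_right ht.2)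
  have key : ∀ t ∈ Ioc 0 r, φ t = c + ∫ x in (0 : ℝ)..t, φ' x := by
    intro t ht
    have h1 := intervalIntegral.integral_interval_sub_left hi (hsub t ht)
    have h2 := intervalIntegral.integral_eq_sub_of_hasDerivAt (f := φ) (f' := φ') (a := t) (b := r)
      (fun x hx => hd x (by
        rw [uIcc_of_le ht.2] at hx; exact ⟨ht.1.trans_le hx.1, hx.2.trans_lt hr.2⟩))
      ((hsub t ht).symm.trans hi)
    rw [hc]; linarith
  by_contra hne
  have hc0 : c ≠ 0 := fun h => hne (by rw [hc] at h; linarith)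
  have hlim : Tendsto (fun t => ∫ x in (0 : ℝ)..t, φ' x) (𝓝[>] 0) (𝓝 0) := by
    simpa using tendsto_primitive hi le_rfl hr.1
  have hev : ∀ᶠ t in 𝓝[>] (0 : ℝ), |∫ x in (0 : ℝ)..t, φ' x| < |c| / 2 := by
    have hpos : |(0 : ℝ)| < |c| / 2 := by simpa using hc0
    exact hlim.abs.eventually (gt_mem_nhds hpos)
  obtain ⟨b, hb0, hb⟩ := mem_nhdsGT_iff_exists_Ioo_subset.1 hev
  obtain ⟨d, hd0, hdb⟩ : ∃ d, 0 < d ∧ d < min b r :=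
    exists_between (lt_min hb0 hr.1)
  have hdr : d < r := hdb.trans_le (min_le_right _ _)
  have hint : IntervalIntegrable (fun x : ℝ => x⁻¹) volume 0 d := by
    have h1 : IntervalIntegrable (fun t => (2 / |c|) * (φ t / t)) volume 0 d :=
      (hdiv.mono_set (by
        rw [uIcc_of_le hd0.le, uIcc_of_le hr.1.le]
        exact Icc_subset_Icc_right hdr.le)).const_mul _
    refine h1.mono_fun (by fun_prop) ?_
    rw [uIoc_of_le hd0.le]
    refine (ae_restrict_iff' measurableSet_Ioc).2 (ae_of_all _ fun t ht => ?_)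
    have ht' : |∫ x in (0 : ℝ)..t, φ' x| < |c| / 2 :=
      hb ⟨ht.1, ht.2.trans_lt (hdb.trans_le (min_le_left _ _))⟩
    have h2 : |c| / 2 ≤ |φ t| := by
      rw [key t ⟨ht.1, ht.2.trans hdr.le⟩]
      have := abs_sub_abs_le_abs_sub c (-∫ x in (0 : ℝ)..t, φ' x)
      rw [abs_neg, sub_neg_eq_add] at this
      linarith
    have hc' : 0 < |c| := abs_pos.2 hc0
    simp only [Real.norm_eq_abs]
    rw [abs_inv, abs_mul, abs_div, abs_div, abs_abs, abs_two]
    have ht0 : 0 < |t| := abs_pos.2 ht.1.ne'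
    rw [inv_eq_one_div, div_mul_div_comm, div_le_div_iff₀ ht0 (by positivity)]
    nlinarith
  rw [intervalIntegrable_inv_iff] at hint
  rcases hint with h | h
  · exact hd0.ne h
  · exact h left_mem_uIcc

/-! ### The radial system of an eigenfunction -/

/-- The one-dimensional system behind the frequency estimates. For an eigenfunction `u` on the
horn, with `dω` the measure of the unit sphere and `f` the warping function, one has
`J = ∫ u² dω`, `G = ∫ u uᵣ dω`, `P = ∫ uᵣ² dω` and `Q = f⁻² ∫ |∇_S u|² dω` on the sphere of radius
`r`, and the weighted volume is `r^α dr dω` up to a constant. The derivative of `r^α G` is Green's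
formula, and `hasDerivAt_e` is the Rellich-Pohozaev identity. -/
structure RadialSystem (α ε lam R : ℝ) (J G P Q : ℝ → ℝ) : Prop where
  one_lt : 1 < α
  eps_pos : 0 < ε
  hasDerivAt_J : ∀ r ∈ Ioo 0 R, HasDerivAt J (2 * G r) r
  hasDerivAt_G : ∀ r ∈ Ioo 0 R,
    HasDerivAt (fun t => t ^ α * G t) (r ^ α * (P r + Q r + lam * J r)) r
  hasDerivAt_e : ∀ r ∈ Ioo 0 R,
    HasDerivAt (fun t => t ^ (α + 1) * (P t - Q t - lam * J t))
      (r ^ α * ((1 - α) * P r + (1 + 2 * ε - α) * Q r - (α + 1) * lam * J r)) r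
  cont_P : ContinuousOn P (Ioo 0 R)
  cont_Q : ContinuousOn Q (Ioo 0 R)
  nonneg_J : ∀ r ∈ Ioo 0 R, 0 ≤ J r
  nonneg_P : ∀ r ∈ Ioo 0 R, 0 ≤ P r
  nonneg_Q : ∀ r ∈ Ioo 0 R, 0 ≤ Q r
  cauchySchwarz : ∀ r ∈ Ioo 0 R, G r ^ 2 ≤ P r * J r
  integrable : ∀ r ∈ Ioo 0 R,
    IntervalIntegrable (fun t => t ^ α * (J t + P t + Q t)) volume 0 r

namespace RadialSystem

variable {α ε lam R : ℝ} {J G P Q : ℝ → ℝ}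

theorem cont_J (S : RadialSystem α ε lam R J G P Q) : ContinuousOn J (Ioo 0 R) :=
  fun r hr => (S.hasDerivAt_J r hr).continuousAt.continuousWithinAt

theorem continuousOn_rpow {p R : ℝ} : ContinuousOn (fun t : ℝ => t ^ p) (Ioo 0 R) :=
  continuousOn_id.rpow_const fun _ hx => Or.inl hx.1.ne'

theorem cont_G (S : RadialSystem α ε lam R J G P Q) : ContinuousOn G (Ioo 0 R) := by
  have h : ContinuousOn (fun t => t ^ α * G t) (Ioo 0 R) :=
    fun r hr => (S.hasDerivAt_G r hr).continuousAt.continuousWithinAt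
  refine ((continuousOn_rpow (p := -α)).mul h).congr fun t ht => ?_
  simp only [Pi.mul_apply]
  rw [← mul_assoc, ← Real.rpow_add ht.1]; simp

/-- A function dominated by the energy density is integrable up to the tip. -/
theorem intervalIntegrable_of_le (S : RadialSystem α ε lam R J G P Q) {h : ℝ → ℝ}
    (hc : ContinuousOn h (Ioo 0 R))
    (hle : ∀ t ∈ Ioo 0 R, |h t| ≤ J t + P t + Q t) {r : ℝ} (hr : r ∈ Ioo 0 R) :
    IntervalIntegrable (fun t => t ^ α * h t) volume 0 r := by
  refine (S.integrable r hr).mono_fun ?_ ?_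
  · rw [uIoc_of_le hr.1.le]
    exact ((continuousOn_rpow.mul hc).mono fun x hx => ⟨hx.1, hx.2.trans_lt hr.2⟩
      ).aestronglyMeasurable measurableSet_Ioc
  · rw [uIoc_of_le hr.1.le]
    refine (ae_restrict_iff' measurableSet_Ioc).2 (ae_of_all _ fun t ht => ?_)
    have ht' : t ∈ Ioo 0 R := ⟨ht.1, ht.2.trans_lt hr.2⟩
    simp only [norm_mul]
    gcongr
    exact (hle t ht').trans (le_abs_self _)

theorem integrable_J (S : RadialSystem α ε lam R J G P Q) {r : ℝ} (hr : r ∈ Ioo 0 R) :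
    IntervalIntegrable (fun t => t ^ α * J t) volume 0 r :=
  S.intervalIntegrable_of_le S.cont_J (fun t ht => by
    rw [abs_of_nonneg (S.nonneg_J t ht)]
    linarith [S.nonneg_P t ht, S.nonneg_Q t ht]) hr

theorem integrable_P (S : RadialSystem α ε lam R J G P Q) {r : ℝ} (hr : r ∈ Ioo 0 R) :
    IntervalIntegrable (fun t => t ^ α * P t) volume 0 r :=
  S.intervalIntegrable_of_le S.cont_P (fun t ht => by
    rw [abs_of_nonneg (S.nonneg_P t ht)]
    linarith [S.nonneg_J t ht, S.nonneg_Q t ht]) hr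

theorem integrable_Q (S : RadialSystem α ε lam R J G P Q) {r : ℝ} (hr : r ∈ Ioo 0 R) :
    IntervalIntegrable (fun t => t ^ α * Q t) volume 0 r :=
  S.intervalIntegrable_of_le S.cont_Q (fun t ht => by
    rw [abs_of_nonneg (S.nonneg_Q t ht)]
    linarith [S.nonneg_P t ht, S.nonneg_J t ht]) hr

/-- The integral of `t^α h(t)` over `(0, r)`, that is, the integral of `h` over the ball `B_r` up to
a constant. -/
noncomputable def ballInt (α : ℝ) (h : ℝ → ℝ) (r : ℝ) : ℝ := ∫ t in (0 : ℝ)..r, t ^ α * h t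

theorem hasDerivAt_ballInt {h : ℝ → ℝ} (hc : ContinuousOn h (Ioo 0 R)) {r : ℝ}
    (hi : IntervalIntegrable (fun t => t ^ α * h t) volume 0 r) (hr : r ∈ Ioo 0 R) :
    HasDerivAt (ballInt α h) (r ^ α * h r) r :=
  hasDerivAt_primitive (continuousOn_rpow.mul hc) hi hr

theorem ballInt_nonneg {h : ℝ → ℝ} (h0 : ∀ t ∈ Ioo 0 R, 0 ≤ h t) {r : ℝ} (hr : r ∈ Ioo 0 R) :
    0 ≤ ballInt α h r :=
  intervalIntegral.integral_nonneg_of_ae_restrict hr.1.le <| by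
    rw [restrict_Ioc_eq_restrict_Icc.symm]
    refine (ae_restrict_iff' measurableSet_Ioc).2 (ae_of_all _ fun t ht => ?_)
    exact mul_nonneg (Real.rpow_nonneg ht.1.le _) (h0 t ⟨ht.1, ht.2.trans_lt hr.2⟩)

/-- Weighted Hardy inequality at the tip; it uses `1 < α`. -/
theorem integrable_rpow_sub_two (S : RadialSystem α ε lam R J G P Q) {r : ℝ} (hr : r ∈ Ioo 0 R) :
    IntervalIntegrable (fun t => t ^ (α - 2) * J t) volume 0 r := by
  have hα := S.one_lt
  have hα1 : 0 < α - 1 := by linarith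
  set c := (α - 1) / 2 with hc
  have hc0 : 0 < c := by positivity
  have hcont : ContinuousOn (fun t => t ^ (α - 2) * J t) (Ioo 0 R) := continuousOn_rpow.mul S.cont_J
  suffices IntervalIntegrable (fun t => c * (t ^ (α - 2) * J t)) volume 0 r by
    have h := this.const_mul c⁻¹
    refine h.congr fun t _ => ?_
    field_simp
  have hsub : Ioc 0 r ⊆ Ioo 0 R := fun x hx => ⟨hx.1, hx.2.trans_lt hr.2⟩
  refine intervalIntegrable_of_bounded (M := r ^ (α - 1) * J r + c⁻¹ * ballInt α P r) hr.1
    ((continuousOn_const.mul hcont).mono hsub) (fun t ht => ?_) fun s hs => ?_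
  · exact mul_nonneg hc0.le (mul_nonneg (Real.rpow_nonneg ht.1.le _) (S.nonneg_J t (hsub ht)))
  have hIcc : Icc s r ⊆ Ioo 0 R := fun x hx => ⟨hs.1.trans_le hx.1, hx.2.trans_lt hr.2⟩
  have hder : ∀ t ∈ Ioo 0 R, HasDerivAt (fun t => t ^ (α - 1) * J t + c⁻¹ * ballInt α P t)
      ((α - 1) * t ^ (α - 1 - 1) * J t + t ^ (α - 1) * (2 * G t) + c⁻¹ * (t ^ α * P t)) t :=
    fun t ht => ((Real.hasDerivAt_rpow_const (Or.inl ht.1.ne')).mul (S.hasDerivAt_J t ht)).add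
      ((hasDerivAt_ballInt S.cont_P (S.integrable_P ht) ht).const_mul _)
  have h1 := intervalIntegral.integral_le_sub_of_hasDeriv_right_of_le (φ := fun t =>
      c * (t ^ (α - 2) * J t)) hs.2.le
    (fun t ht => (hder t (hIcc ht)).continuousAt.continuousWithinAt)
    (fun t ht => (hder t (hIcc (Ioo_subset_Icc_self ht))).hasDerivWithinAt)
    ((continuousOn_const.mul hcont).mono hIcc).integrableOn_Icc ?_
  · have h2 := S.nonneg_J s ⟨hs.1, hs.2.trans hr.2⟩
    have h3 := Real.rpow_nonneg hs.1.le (α - 1)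
    have h4 : 0 ≤ ballInt α P s := ballInt_nonneg S.nonneg_P ⟨hs.1, hs.2.trans hr.2⟩
    have : 0 ≤ s ^ (α - 1) * J s + c⁻¹ * ballInt α P s := by positivity
    linarith
  · intro t ht
    have ht' := hIcc (Ioo_subset_Icc_self ht)
    have e1 : t ^ (α - 1) = t ^ (α - 2) * t := by
      rw [← Real.rpow_add_one ht'.1.ne']; ring_nf
    have e2 : t ^ α = t ^ (α - 2) * t ^ 2 := by
      rw [← Real.rpow_natCast, ← Real.rpow_add ht'.1]; norm_num
    have e3 : α - 1 - 1 = α - 2 := by ring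
    rw [e1, e2, e3]
    have hp := Real.rpow_nonneg ht'.1.le (α - 2)
    have hcs := S.cauchySchwarz t ht'
    have hJ := S.nonneg_J t ht'
    have hP := S.nonneg_P t ht'
    -- the quadratic form `c J + 2 t G + c⁻¹ t² P` is nonnegative by `G² ≤ P J`
    have hq : 0 ≤ c * J t + 2 * t * G t + c⁻¹ * t ^ 2 * P t := by
      have : |2 * t * G t| ≤ c * J t + c⁻¹ * t ^ 2 * P t := by
        apply abs_le_of_sq_le_sq _ (by positivity)
        have e : (c * J t) * (c⁻¹ * t ^ 2 * P t) = t ^ 2 * (P t * J t) := by field_simp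
        nlinarith [sq_nonneg (c * J t - c⁻¹ * t ^ 2 * P t), sq_nonneg t]
      linarith [neg_abs_le (2 * t * G t)]
    have e4 : α - 1 = 2 * c := by rw [hc]; ring
    rw [e4]
    nlinarith [mul_nonneg hp hq]

theorem integral_comb (S : RadialSystem α ε lam R J G P Q) {r : ℝ} (hr : r ∈ Ioo 0 R)
    (a b c : ℝ) :
    IntervalIntegrable (fun t => t ^ α * (a * P t + b * Q t + c * J t)) volume 0 r ∧
    ∫ t in (0 : ℝ)..r, t ^ α * (a * P t + b * Q t + c * J t) =
      a * ballInt α P r + b * ballInt α Q r + c * ballInt α J r := by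
  have hP := (S.integrable_P hr).const_mul a
  have hQ := (S.integrable_Q hr).const_mul b
  have hJ := (S.integrable_J hr).const_mul c
  have e : (fun t => t ^ α * (a * P t + b * Q t + c * J t)) =
      fun t => a * (t ^ α * P t) + b * (t ^ α * Q t) + c * (t ^ α * J t) := by
    funext t; ring
  rw [e]
  refine ⟨(hP.add hQ).add hJ, ?_⟩
  rw [intervalIntegral.integral_add (hP.add hQ) hJ, intervalIntegral.integral_add hP hQ,
    intervalIntegral.integral_const_mul, intervalIntegral.integral_const_mul,
    intervalIntegral.integral_const_mul]
  rfl

/-- Green's formula on the ball: there is no contribution of the tip. -/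
theorem green (S : RadialSystem α ε lam R J G P Q) {r : ℝ} (hr : r ∈ Ioo 0 R) :
    r ^ α * G r = ballInt α P r + ballInt α Q r + lam * ballInt α J r := by
  obtain ⟨hi, he⟩ := S.integral_comb hr 1 1 lam
  rw [one_mul, one_mul] at he
  rw [← he]
  refine eq_primitive_of_integrable_div (φ := fun t => t ^ α * G t) (fun t ht => ?_) hr hi ?_
  · simpa using S.hasDerivAt_G t ht
  have hsub : Ioc 0 r ⊆ Ioo 0 R := fun x hx => ⟨hx.1, hx.2.trans_lt hr.2⟩
  refine ((S.integrable_P hr).add (S.integrable_rpow_sub_two hr)).mono_fun ?_ ?_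
  · rw [uIoc_of_le hr.1.le]
    refine ContinuousOn.aestronglyMeasurable ?_ measurableSet_Ioc
    exact ((continuousOn_rpow.mul S.cont_G).div continuousOn_id fun x hx => hx.1.ne').mono hsub
  · rw [uIoc_of_le hr.1.le]
    refine (ae_restrict_iff' measurableSet_Ioc).2 (ae_of_all _ fun t ht => ?_)
    have ht' := hsub ht
    have e2 : t ^ α = t ^ (α - 2) * t ^ 2 := by
      rw [← Real.rpow_natCast, ← Real.rpow_add ht'.1]; norm_num
    have hp := Real.rpow_nonneg ht'.1.le (α - 2)
    have hcs := S.cauchySchwarz t ht'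
    have hJ := S.nonneg_J t ht'
    have hP := S.nonneg_P t ht'
    have ht0 := ht.1
    simp only [Real.norm_eq_abs]
    refine le_trans ?_ (le_abs_self _)
    rw [e2]
    have h1 : |t * G t| ≤ t ^ 2 * P t + J t := by
      apply abs_le_of_sq_le_sq _ (by positivity)
      nlinarith [sq_nonneg (t ^ 2 * P t - J t), mul_nonneg (mul_nonneg (sq_nonneg t) hP) hJ,
        mul_le_mul_of_nonneg_left hcs (sq_nonneg t)]
    calc |t ^ (α - 2) * t ^ 2 * G t / t| = t ^ (α - 2) * |t * G t| := by
          rw [show t ^ (α - 2) * t ^ 2 * G t / t = t ^ (α - 2) * (t * G t) by field_simp,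
            abs_mul, abs_of_nonneg hp]
      _ ≤ t ^ (α - 2) * (t ^ 2 * P t + J t) := by gcongr
      _ = _ := by ring

/-- The Rellich-Pohozaev identity on the ball: there is no contribution of the tip. -/
theorem pohozaev (S : RadialSystem α ε lam R J G P Q) {r : ℝ} (hr : r ∈ Ioo 0 R) :
    r ^ (α + 1) * (P r - Q r - lam * J r) = (1 - α) * ballInt α P r +
      (1 + 2 * ε - α) * ballInt α Q r - (α + 1) * lam * ballInt α J r := by
  obtain ⟨hi, he⟩ := S.integral_comb hr (1 - α) (1 + 2 * ε - α) (-((α + 1) * lam))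
  rw [neg_mul, ← sub_eq_add_neg] at he
  rw [← he]
  refine eq_primitive_of_integrable_div
    (φ := fun t => t ^ (α + 1) * (P t - Q t - lam * J t)) (fun t ht => ?_) hr hi ?_
  · convert S.hasDerivAt_e t ht using 2; ring
  refine (S.integral_comb hr 1 (-1) (-lam)).1.congr ?_
  intro t ht
  rw [uIoc_of_le hr.1.le] at ht
  have := ht.1.ne'
  simp only
  rw [Real.rpow_add_one this]
  field_simp
  ring

/-! ### Almost monotonicity of the frequency -/

/-- Hardy inequality on the annulus `B_r ∖ B_s` for a function vanishing on `B_s` (no condition if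
`s = 0`); the constants tend to `0` with the width of the annulus. -/
theorem hardy (S : RadialSystem α ε lam R J G P Q) {s r : ℝ} (hs : 0 ≤ s) (hsr : s < r)
    (hrR : r < R) (h0 : ballInt α J s = 0) :
    ballInt α J r ≤ 2 * (r - s) * r ^ α * J r + 4 * (r - s) ^ 2 * ballInt α P r := by
  have hα := S.one_lt
  have hIoc : Ioc s r ⊆ Ioo 0 R := fun x hx => ⟨hs.trans_lt hx.1, hx.2.trans_lt hrR⟩
  have hr : r ∈ Ioo 0 R := hIoc ⟨hsr, le_rfl⟩
  -- monotone, because the cross term `2 (t - s) t^α G` of the derivative is at most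
  -- `t^α (J / 2 + 2 (t - s)² P)`
  set Φ : ℝ → ℝ := fun t => (t - s) * t ^ α * J t - 1 / 2 * ballInt α J t +
    2 * (r - s) ^ 2 * ballInt α P t with hΦ
  have hmono : MonotoneOn Φ (Ioc s r) := by
    refine monotoneOn_of_hasDerivAt_nonneg (convex_Ioc s r)
      (f' := fun t => (1 * t ^ α + (t - s) * (α * t ^ (α - 1))) * J t +
        (t - s) * t ^ α * (2 * G t) - 1 / 2 * (t ^ α * J t) +
        2 * (r - s) ^ 2 * (t ^ α * P t)) (fun t ht => ?_) fun t ht => ?_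
    · have ht' := hIoc ht
      exact ((((((hasDerivAt_id t).sub_const s).mul
        (Real.hasDerivAt_rpow_const (Or.inl ht'.1.ne'))).mul (S.hasDerivAt_J t ht')).sub
        ((hasDerivAt_ballInt S.cont_J (S.integrable_J ht') ht').const_mul _)).add
        ((hasDerivAt_ballInt S.cont_P (S.integrable_P ht') ht').const_mul _))
    · have ht' := hIoc ht
      have hp := Real.rpow_nonneg ht'.1.le α
      have hp1 := Real.rpow_nonneg ht'.1.le (α - 1)
      have hcs := S.cauchySchwarz t ht'
      have hJ := S.nonneg_J t ht'
      have hP := S.nonneg_P t ht'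
      have hts : 0 < t - s := sub_pos.2 ht.1
      have hd : (t - s) ^ 2 ≤ (r - s) ^ 2 := by
        apply pow_le_pow_left₀ hts.le; linarith [ht.2]
      have h1 : |2 * (t - s) * G t| ≤ 1 / 2 * J t + 2 * (t - s) ^ 2 * P t := by
        apply abs_le_of_sq_le_sq _ (by positivity)
        nlinarith [sq_nonneg (1 / 2 * J t - 2 * (t - s) ^ 2 * P t),
          mul_le_mul_of_nonneg_left hcs (sq_nonneg (t - s))]
      have h2 : 0 ≤ 1 / 2 * J t + 2 * (t - s) * G t + 2 * (r - s) ^ 2 * P t := by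
        have := mul_le_mul_of_nonneg_right hd hP
        linarith [neg_abs_le (2 * (t - s) * G t)]
      have h3 : 0 ≤ (t - s) * (α * t ^ (α - 1)) * J t := by positivity
      nlinarith [mul_nonneg hp h2]
  have hlow : ∀ᶠ t in 𝓝[>] s, -(1 / 2) * ballInt α J t ≤ Φ r := by
    filter_upwards [Ioo_mem_nhdsGT hsr] with t ht
    have ht' := hIoc ⟨ht.1, ht.2.le⟩
    refine le_trans ?_ (hmono ⟨ht.1, ht.2.le⟩ ⟨hsr, le_rfl⟩ ht.2.le)
    have h1 : 0 ≤ ballInt α P t := ballInt_nonneg S.nonneg_P ht'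
    have hJ := S.nonneg_J t ht'
    have hts : 0 < t - s := sub_pos.2 ht.1
    have hp := Real.rpow_nonneg ht'.1.le α
    have : 0 ≤ (t - s) * t ^ α * J t + 2 * (r - s) ^ 2 * ballInt α P t := by positivity
    rw [hΦ]; simp only; linarith
  have hlim : Tendsto (fun t => -(1 / 2) * ballInt α J t) (𝓝[>] s) (𝓝 (-(1 / 2) * 0)) := by
    rw [← h0]
    exact (tendsto_primitive (S.integrable_J hr) hs hsr).const_mul _
  have hfin := le_of_tendsto hlim hlow
  rw [hΦ] at hfin; simp only at hfin
  linarith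

/-- Size of the negative part of the eigenvalue parameter. -/
noncomputable def lamNeg (lam : ℝ) : ℝ := max (-lam) 0

/-- Annuli of width `d` are narrow enough for the Hardy inequality to absorb the negative part of
`lam`. -/
def IsSmall (ε lam d : ℝ) : Prop := 8 * (1 + ε) * lamNeg lam * d ^ 2 ≤ ε

theorem IsSmall.mono {d d' : ℝ} (hε : 0 < ε) (h : IsSmall ε lam d) (h0 : 0 ≤ d') (hd : d' ≤ d) :
    IsSmall ε lam d' := by
  unfold IsSmall at *
  have h1 : d' ^ 2 ≤ d ^ 2 := pow_le_pow_left₀ h0 hd 2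
  have h2 : 0 ≤ 8 * (1 + ε) * lamNeg lam := by
    have : 0 ≤ lamNeg lam := le_max_right _ _
    positivity
  nlinarith

/-- The error constant in the almost monotonicity of the frequency. -/
noncomputable def errConst (ε lam : ℝ) : ℝ := (4 + 4 * ε) * lamNeg lam

theorem errConst_nonneg (hε : 0 < ε) : 0 ≤ errConst ε lam := by
  have : 0 ≤ lamNeg lam := le_max_right _ _
  unfold errConst; positivity

/-- The normalized frequency `r^{2ε} U(r)`, where `U = r G / J`. -/
noncomputable def normFreq (ε : ℝ) (J G : ℝ → ℝ) (t : ℝ) : ℝ := t ^ (2 * ε + 1) * G t / J t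

theorem hasDerivAt_G' (S : RadialSystem α ε lam R J G P Q) {r : ℝ} (hr : r ∈ Ioo 0 R) :
    HasDerivAt G (P r + Q r + lam * J r - α * G r / r) r := by
  have h := (Real.hasDerivAt_rpow_const (p := -α) (Or.inl hr.1.ne')).mul (S.hasDerivAt_G r hr)
  have h2 : HasDerivAt G (-α * r ^ (-α - 1) * (r ^ α * G r) +
      r ^ (-α) * (r ^ α * (P r + Q r + lam * J r))) r := by
    refine h.congr_of_eventuallyEq ?_
    filter_upwards [isOpen_Ioo.mem_nhds hr] with t ht
    simp only [Pi.mul_apply]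
    rw [← mul_assoc, ← Real.rpow_add ht.1]; simp
  convert h2 using 1
  have e1 : r ^ (-α) * r ^ α = 1 := by rw [← Real.rpow_add hr.1]; simp
  have e2 : r ^ (-α - 1) * r ^ α = r⁻¹ := by
    rw [← Real.rpow_add hr.1, ← Real.rpow_neg_one]; ring_nf
  rw [← mul_assoc (r ^ (-α)), e1, mul_comm (r ^ α) (G r), mul_comm (G r), ← mul_assoc,
    mul_assoc (-α), e2]
  field_simp
  ring

/-- Almost monotonicity of `r^{2ε} U(r)` on narrow annuli, with the gain `ε ∫_{B_r} uᵣ²`. The terms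
of the derivative are compared by the Cauchy-Schwarz inequality, Green's formula and the
Rellich-Pohozaev identity. -/
theorem hasDerivAt_normFreq (S : RadialSystem α ε lam R J G P Q) {s r : ℝ} (hs : 0 ≤ s)
    (hsr : s < r) (hrR : r < R) (h0 : ballInt α J s = 0) (hsm : IsSmall ε lam (r - s))
    (hJ : 0 < J r) :
    ∃ V', HasDerivAt (normFreq ε J G) V' r ∧
      ε * r ^ (2 * ε - α) * ballInt α P r / J r - errConst ε lam * r ^ (2 * ε + 1) ≤ V' := by
  have hr : r ∈ Ioo 0 R := ⟨hs.trans_lt hsr, hrR⟩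
  have hr0 := hr.1
  refine ⟨_, ((Real.hasDerivAt_rpow_const (p := 2 * ε + 1) (Or.inl hr0.ne')).mul
    (S.hasDerivAt_G' hr)).div (S.hasDerivAt_J r hr) hJ.ne', ?_⟩
  have hε := S.eps_pos
  have hA : 0 ≤ ballInt α J r := ballInt_nonneg S.nonneg_J hr
  have hB : 0 ≤ ballInt α P r := ballInt_nonneg S.nonneg_P hr
  have hgreen := S.green hr
  have hpoh := S.pohozaev hr
  have hhardy := S.hardy hs hsr hrR h0
  have hcs := S.cauchySchwarz r hr
  have hl : 0 ≤ lamNeg lam := le_max_right _ _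
  have hl' : -lamNeg lam ≤ lam := by
    have : -lam ≤ lamNeg lam := le_max_left _ _
    linarith
  have hpa : 0 < r ^ α := Real.rpow_pos_of_pos hr0 _
  have hpb : 0 < r ^ (2 * ε) := Real.rpow_pos_of_pos hr0 _
  have e1 : r ^ (2 * ε + 1) = r ^ (2 * ε) * r := Real.rpow_add_one hr0.ne' _
  have e2 : r ^ (2 * ε - α) = r ^ (2 * ε) / r ^ α := Real.rpow_sub hr0 _ _
  have e3 : r ^ (2 * ε + 1 - 1) = r ^ (2 * ε) := by ring_nf
  have e4 : r ^ (α + 1) = r ^ α * r := Real.rpow_add_one hr0.ne' _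
  rw [e4] at hpoh
  rw [Pi.mul_apply, e3, e1, e2]
  generalize r ^ (2 * ε) = b at *
  generalize r ^ α = a at *
  generalize ballInt α J r = A at *
  generalize ballInt α P r = B at *
  generalize ballInt α Q r = C at *
  unfold errConst
  unfold IsSmall at hsm
  generalize lamNeg lam = l at *
  generalize hd : r - s = d at *
  have hd0 : 0 < d := by linarith
  have hdr : d ≤ r := by linarith
  -- the boundary terms, by Green and Rellich-Pohozaev
  have h1 : a * ((1 + 2 * ε - α) * G r + r * (Q r + lam * J r - P r)) =
      2 * ε * B + (2 + 2 * ε) * lam * A := by linear_combination (1 + 2 * ε - α) * hgreen - hpoh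
  -- absorption of the negative part of `lam`
  have h2 : ε * B - (4 + 4 * ε) * l * r * (a * J r) ≤ 2 * ε * B + (2 + 2 * ε) * lam * A := by
    have i1 : (2 + 2 * ε) * (-l * A) ≤ (2 + 2 * ε) * (lam * A) := by
      have := mul_le_mul_of_nonneg_right hl' hA
      gcongr
    have i2 : (2 + 2 * ε) * l * A ≤
        (2 + 2 * ε) * l * (2 * d * a * J r + 4 * d ^ 2 * B) := by gcongr
    have i3 : 8 * (1 + ε) * l * d ^ 2 * B ≤ ε * B := by gcongr
    have i4 : (4 + 4 * ε) * l * d * (a * J r) ≤ (4 + 4 * ε) * l * r * (a * J r) := by gcongr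
    linarith
  have h3 : r * G r ^ 2 / J r ≤ r * P r := by
    rw [div_le_iff₀ hJ, mul_assoc]; gcongr
  have h4 : ((2 * ε + 1) * b * G r + b * r * (P r + Q r + lam * J r - α * G r / r)) * J r -
      b * r * G r * (2 * G r) = b * J r * ((1 + 2 * ε - α) * G r + r * (Q r + lam * J r - P r) +
        2 * (r * P r - r * G r ^ 2 / J r)) := by
    field_simp; ring
  rw [h4]
  have h5 : ε * B / a - (4 + 4 * ε) * l * r * J r ≤
      (1 + 2 * ε - α) * G r + r * (Q r + lam * J r - P r) + 2 * (r * P r - r * G r ^ 2 / J r) := by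
    have : ε * B / a - (4 + 4 * ε) * l * r * J r ≤
        (1 + 2 * ε - α) * G r + r * (Q r + lam * J r - P r) := by
      rw [sub_le_iff_le_add, div_le_iff₀ hpa]
      nlinarith
    linarith
  calc ε * (b / a) * B / J r - (4 + 4 * ε) * l * (b * r)
      = b / J r * (ε * B / a - (4 + 4 * ε) * l * r * J r) := by field_simp
    _ ≤ b / J r * ((1 + 2 * ε - α) * G r + r * (Q r + lam * J r - P r) +
        2 * (r * P r - r * G r ^ 2 / J r)) := by gcongr
    _ = _ := by field_simp

/-- The normalized frequency with the correction that makes it monotone. -/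
noncomputable def monoFreq (ε lam : ℝ) (J G : ℝ → ℝ) (t : ℝ) : ℝ :=
  normFreq ε J G t + errConst ε lam / (2 * ε + 2) * t ^ (2 * ε + 2)

theorem hasDerivAt_monoFreq (S : RadialSystem α ε lam R J G P Q) {s r : ℝ} (hs : 0 ≤ s)
    (hsr : s < r) (hrR : r < R) (h0 : ballInt α J s = 0) (hsm : IsSmall ε lam (r - s))
    (hJ : 0 < J r) :
    ∃ W', HasDerivAt (monoFreq ε lam J G) W' r ∧
      ε * r ^ (2 * ε - α) * ballInt α P r / J r ≤ W' := by
  obtain ⟨V', hV, hle⟩ := S.hasDerivAt_normFreq hs hsr hrR h0 hsm hJ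
  have hε := S.eps_pos
  refine ⟨_, hV.add ((Real.hasDerivAt_rpow_const (p := 2 * ε + 2)
    (Or.inl (hs.trans_lt hsr).ne')).const_mul _), ?_⟩
  have e : 2 * ε + 2 - 1 = 2 * ε + 1 := by ring
  rw [e, ← mul_assoc, div_mul_cancel₀ _ (by positivity)]
  linarith

theorem monotoneOn_monoFreq (S : RadialSystem α ε lam R J G P Q) {s b : ℝ} (hs : 0 ≤ s)
    (hbR : b < R) (h0 : ballInt α J s = 0) (hsm : IsSmall ε lam (b - s))
    (hJ : ∀ t ∈ Ioc s b, 0 < J t) : MonotoneOn (monoFreq ε lam J G) (Ioc s b) := by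
  have hε := S.eps_pos
  have h : ∀ t ∈ Ioc s b, ∃ W', HasDerivAt (monoFreq ε lam J G) W' t ∧ 0 ≤ W' := by
    intro t ht
    obtain ⟨W', h1, h2⟩ := S.hasDerivAt_monoFreq hs ht.1 (ht.2.trans_lt hbR) h0
      (hsm.mono hε (sub_nonneg.2 ht.1.le) (by linarith [ht.2])) (hJ t ht)
    refine ⟨W', h1, le_trans ?_ h2⟩
    have ht0 : 0 < t := hs.trans_lt ht.1
    have : 0 ≤ ballInt α P t := ballInt_nonneg S.nonneg_P ⟨ht0, ht.2.trans_lt hbR⟩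
    have := hJ t ht
    positivity
  choose! W' h1 h2 using h
  exact monotoneOn_of_hasDerivAt_nonneg (convex_Ioc s b) h1 h2

theorem normFreq_le_monoFreq (hε : 0 < ε) {t : ℝ} (ht : 0 ≤ t) :
    normFreq ε J G t ≤ monoFreq ε lam J G t := by
  have := errConst_nonneg (lam := lam) hε
  unfold monoFreq
  have : 0 ≤ errConst ε lam / (2 * ε + 2) * t ^ (2 * ε + 2) := by positivity
  linarith

/-- An upper bound `K` of the normalized frequency bounds the decay of `J` towards the tip. -/
theorem log_lower_bound (S : RadialSystem α ε lam R J G P Q) {r b K : ℝ} (hr : 0 < r) (hrb : r ≤ b)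
    (hbR : b < R) (hK : 0 ≤ K) (hJ : ∀ t ∈ Icc r b, 0 < J t)
    (hV : ∀ t ∈ Icc r b, normFreq ε J G t ≤ K) :
    J b * Real.exp (-(K / ε * r ^ (-2 * ε))) ≤ J r := by
  have hε := S.eps_pos
  have hmono : MonotoneOn (fun t => -(Real.log (J t) + K / ε * t ^ (-2 * ε))) (Icc r b) := by
    refine monotoneOn_of_hasDerivAt_nonneg (convex_Icc r b)
      (f' := fun t => -(2 * G t / J t + K / ε * (-2 * ε * t ^ (-2 * ε - 1)))) (fun t ht => ?_)
      fun t ht => ?_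
    · have ht' : t ∈ Ioo 0 R := ⟨hr.trans_le ht.1, ht.2.trans_lt hbR⟩
      exact (((S.hasDerivAt_J t ht').log (hJ t ht).ne').add
        ((Real.hasDerivAt_rpow_const (Or.inl ht'.1.ne')).const_mul _)).neg
    · have ht0 : 0 < t := hr.trans_le ht.1
      have h1 := hV t ht
      unfold normFreq at h1
      have e : t ^ (-2 * ε - 1) * t ^ (2 * ε + 1) = 1 := by
        rw [← Real.rpow_add ht0]; ring_nf; simp
      have hp : 0 ≤ t ^ (-2 * ε - 1) := by positivity
      have h2 : G t / J t ≤ t ^ (-2 * ε - 1) * K := by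
        calc G t / J t = t ^ (-2 * ε - 1) * (t ^ (2 * ε + 1) * G t / J t) := by
              rw [mul_div_assoc, ← mul_assoc, e, one_mul]
          _ ≤ _ := by gcongr
      have e2 : K / ε * (-2 * ε * t ^ (-2 * ε - 1)) = -2 * (t ^ (-2 * ε - 1) * K) := by
        field_simp
      rw [e2, mul_div_assoc]
      linarith
  have h := hmono ⟨le_rfl, hrb⟩ ⟨hrb, le_rfl⟩ hrb
  simp only at h
  have hb0 : 0 < b := hr.trans_le hrb
  have h1 : 0 ≤ K / ε * b ^ (-2 * ε) := by positivity
  have hJr := hJ r ⟨le_rfl, hrb⟩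
  have hJb := hJ b ⟨hrb, le_rfl⟩
  rw [← Real.exp_log hJb, ← Real.exp_add, ← Real.exp_log hJr, Real.exp_le_exp]
  linarith

/-! ### Unique continuation for the radial system -/

theorem ballInt_eq_zero {s : ℝ} (hs : 0 ≤ s)
    (h : ∀ t ∈ Ioo 0 s, J t = 0) : ballInt α J s = 0 := by
  unfold ballInt
  rw [intervalIntegral.integral_of_le hs, integral_Ioc_eq_integral_Ioo]
  exact setIntegral_eq_zero_of_forall_eq_zero fun t ht => by rw [h t ht, mul_zero]

theorem eq_zero_of_ballInt_eq_zero {h : ℝ → ℝ} (hc : ContinuousOn h (Ioo 0 R))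
    (h0 : ∀ t ∈ Ioo 0 R, 0 ≤ h t)
    (hi : ∀ r ∈ Ioo 0 R, IntervalIntegrable (fun t => t ^ α * h t) volume 0 r)
    {r : ℝ} (hr : r ∈ Ioo 0 R) (hz : ballInt α h r = 0) : ∀ t ∈ Ioo 0 r, h t = 0 := by
  have hsub : Ioo 0 r ⊆ Ioo 0 R := Ioo_subset_Ioo_right hr.2.le
  have hmono : MonotoneOn (ballInt α h) (Ioo 0 R) :=
    monotoneOn_of_hasDerivAt_nonneg (convex_Ioo 0 R)
      (fun t ht => hasDerivAt_ballInt hc (hi t ht) ht)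
      fun t ht => mul_nonneg (Real.rpow_nonneg ht.1.le _) (h0 t ht)
  have hzero : ∀ t ∈ Ioo 0 r, ballInt α h t = 0 := fun t ht =>
    le_antisymm ((hmono (hsub ht) hr ht.2.le).trans_eq hz) (ballInt_nonneg h0 (hsub ht))
  intro t ht
  have h1 := hasDerivAt_ballInt hc (hi t (hsub ht)) (hsub ht)
  have h2 : HasDerivAt (ballInt α h) 0 t := by
    refine (hasDerivAt_const t (0 : ℝ)).congr_of_eventuallyEq ?_
    filter_upwards [isOpen_Ioo.mem_nhds ht] with x hx using hzero x hx
  have h3 := h1.unique h2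
  have : t ^ α ≠ 0 := (Real.rpow_pos_of_pos ht.1 _).ne'
  simpa [this] using h3

/-- If `u` vanishes on `B_s` and on a nearby sphere `∂B_r`, then it vanishes on `B_r`. -/
theorem eq_zero_inward (S : RadialSystem α ε lam R J G P Q) {s r : ℝ} (hs : 0 ≤ s) (hsr : s < r)
    (hrR : r < R) (h0 : ballInt α J s = 0) (hsm : IsSmall ε lam (r - s)) (hJ : J r = 0) :
    ∀ t ∈ Ioc 0 r, J t = 0 := by
  have hr : r ∈ Ioo 0 R := ⟨hs.trans_lt hsr, hrR⟩
  have hε := S.eps_pos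
  have hcs := S.cauchySchwarz r hr
  have hG : G r = 0 := by rw [hJ, mul_zero] at hcs; nlinarith
  have hgreen := S.green hr
  have hhardy := S.hardy hs hsr hrR h0
  rw [hG, mul_zero] at hgreen
  rw [hJ, mul_zero, zero_add] at hhardy
  have hA : 0 ≤ ballInt α J r := ballInt_nonneg S.nonneg_J hr
  have hB : 0 ≤ ballInt α P r := ballInt_nonneg S.nonneg_P hr
  have hC : 0 ≤ ballInt α Q r := ballInt_nonneg S.nonneg_Q hr
  have hl : 0 ≤ lamNeg lam := le_max_right _ _
  have hl' : -lamNeg lam ≤ lam := by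
    have : -lam ≤ lamNeg lam := le_max_left _ _
    linarith
  have h1 : lamNeg lam * ballInt α J r ≤ 1 / 2 * ballInt α P r := by
    have i1 := mul_le_mul_of_nonneg_left hhardy hl
    have i2 : lamNeg lam * (4 * (r - s) ^ 2) ≤ 1 / 2 := by
      unfold IsSmall at hsm
      have : (1 + ε) * (8 * lamNeg lam * (r - s) ^ 2) ≤ (1 + ε) * 1 := by linarith
      have := le_of_mul_le_mul_left this (by positivity)
      linarith
    nlinarith
  have h2 : ballInt α P r = 0 := by nlinarith [mul_le_mul_of_nonneg_right hl' hA]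
  have h3 : ballInt α J r = 0 := by rw [h2, mul_zero] at hhardy; linarith
  intro t ht
  rcases ht.2.eq_or_lt with h | h
  · rw [h, hJ]
  · exact eq_zero_of_ballInt_eq_zero S.cont_J S.nonneg_J (fun _ => S.integrable_J) hr h3 t
      ⟨ht.1, h⟩

theorem exists_isSmall (hε : 0 < ε) : ∃ d, 0 < d ∧ IsSmall ε lam d := by
  have h1 : Tendsto (fun d : ℝ => 8 * (1 + ε) * lamNeg lam * d ^ 2) (𝓝[>] 0)
      (𝓝 (8 * (1 + ε) * lamNeg lam * 0 ^ 2)) :=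
    ((continuous_const.mul (continuous_pow 2)).tendsto 0).mono_left nhdsWithin_le_nhds
  have h2 := h1.eventually (ge_mem_nhds (show _ < ε by simpa using hε))
  obtain ⟨d, hd, hd'⟩ := (h2.and self_mem_nhdsWithin).exists
  exact ⟨d, hd', hd⟩

/-- Unique continuation across a sphere: the frequency is bounded above on a narrow annulus around
`B_s`, so `J` cannot tend to `0` at `∂B_s`. -/
theorem exists_gt_eq_zero (S : RadialSystem α ε lam R J G P Q) {s : ℝ} (hs : s ∈ Ioo 0 R)
    (h : ∀ t ∈ Ioc 0 s, J t = 0) : ∃ b ∈ Ioo s R, ∀ t ∈ Ioc 0 b, J t = 0 := by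
  have hε := S.eps_pos
  obtain ⟨d, hd, hsm⟩ := exists_isSmall (ε := ε) (lam := lam) hε
  obtain ⟨b, hsb, hb⟩ : ∃ b, s < b ∧ b < min R (s + d) :=
    exists_between (lt_min hs.2 (by linarith))
  have hbR : b < R := hb.trans_le (min_le_left _ _)
  have hbd : b < s + d := hb.trans_le (min_le_right _ _)
  have h0 : ballInt α J s = 0 :=
    ballInt_eq_zero hs.1.le fun t ht => h t ⟨ht.1, ht.2.le⟩
  by_cases hz : ∃ r ∈ Ioc s b, J r = 0
  · obtain ⟨r, hr, hJr⟩ := hz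
    exact ⟨r, ⟨hr.1, hr.2.trans_lt hbR⟩, S.eq_zero_inward hs.1.le hr.1 (hr.2.trans_lt hbR) h0
      (hsm.mono hε (by linarith [hr.1]) (by linarith [hr.2])) hJr⟩
  exfalso
  push Not at hz
  have hpos : ∀ t ∈ Ioc s b, 0 < J t := fun t ht =>
    (S.nonneg_J t ⟨hs.1.trans ht.1, ht.2.trans_lt hbR⟩).lt_of_ne' (hz t ht)
  have hmono := S.monotoneOn_monoFreq hs.1.le hbR h0
    (hsm.mono hε (by linarith) (by linarith)) hpos
  set K := max (monoFreq ε lam J G b) 0 with hK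
  have hV : ∀ t ∈ Ioc s b, normFreq ε J G t ≤ K := fun t ht =>
    (normFreq_le_monoFreq hε (hs.1.trans ht.1).le).trans
      ((hmono ht ⟨hsb, le_rfl⟩ ht.2).trans (le_max_left _ _))
  have hlow : ∀ᶠ r in 𝓝[>] s, J b * Real.exp (-(K / ε * r ^ (-2 * ε))) ≤ J r := by
    filter_upwards [Ioo_mem_nhdsGT hsb] with r hr
    exact S.log_lower_bound (hs.1.trans hr.1) hr.2.le hbR (le_max_right _ _)
      (fun t ht => hpos t ⟨hr.1.trans_le ht.1, ht.2⟩)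
      (fun t ht => hV t ⟨hr.1.trans_le ht.1, ht.2⟩)
  have hc1 : Tendsto J (𝓝[>] s) (𝓝 (J s)) :=
    (S.hasDerivAt_J s hs).continuousAt.mono_left nhdsWithin_le_nhds
  have hc2 : Tendsto (fun r : ℝ => J b * Real.exp (-(K / ε * r ^ (-2 * ε)))) (𝓝[>] s)
      (𝓝 (J b * Real.exp (-(K / ε * s ^ (-2 * ε))))) := by
    refine Tendsto.mono_left ?_ nhdsWithin_le_nhds
    have : ContinuousAt (fun r : ℝ => r ^ (-2 * ε)) s :=
      Real.continuousAt_rpow_const _ _ (Or.inl hs.1.ne')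
    exact ((Real.continuous_exp.continuousAt.comp (this.const_mul (K / ε)).neg).const_mul _)
  have := le_of_tendsto_of_tendsto hc2 hc1 hlow
  rw [h s ⟨hs.1, le_rfl⟩] at this
  have := mul_pos (hpos b ⟨hsb, le_rfl⟩) (Real.exp_pos (-(K / ε * s ^ (-2 * ε))))
  linarith

theorem eq_zero_of_eq_zero_ball (S : RadialSystem α ε lam R J G P Q) {s : ℝ} (hs : s ∈ Ioo 0 R)
    (h : ∀ t ∈ Ioc 0 s, J t = 0) : ∀ t ∈ Ioo 0 R, J t = 0 := by
  set Z : Set ℝ := {a | a ∈ Ioo 0 R ∧ ∀ t ∈ Ioc 0 a, J t = 0} with hZ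
  have hsZ : s ∈ Z := ⟨hs, h⟩
  have hbdd : BddAbove Z := ⟨R, fun a ha => ha.1.2.le⟩
  have hlt : ∀ t ∈ Ioo 0 (sSup Z), J t = 0 := by
    intro t ht
    obtain ⟨a, ha, hta⟩ := exists_lt_of_lt_csSup ⟨s, hsZ⟩ ht.2
    exact ha.2 t ⟨ht.1, hta.le⟩
  have hsup0 : 0 < sSup Z := hs.1.trans_le (le_csSup hbdd hsZ)
  rcases lt_or_ge (sSup Z) R with hR | hR
  · exfalso
    have hm : sSup Z ∈ Ioo 0 R := ⟨hsup0, hR⟩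
    have hz : J (sSup Z) = 0 := by
      have hc : Tendsto J (𝓝[<] (sSup Z)) (𝓝 (J (sSup Z))) :=
        (S.hasDerivAt_J _ hm).continuousAt.mono_left nhdsWithin_le_nhds
      refine tendsto_nhds_unique hc (tendsto_const_nhds.congr' ?_)
      filter_upwards [Ioo_mem_nhdsLT hsup0] with t ht using (hlt t ht).symm
    obtain ⟨b, hb, hb'⟩ := S.exists_gt_eq_zero hm fun t ht =>
      ht.2.eq_or_lt.elim (fun e => e ▸ hz) fun hl => hlt t ⟨ht.1, hl⟩
    have : b ≤ sSup Z := le_csSup hbdd ⟨⟨hsup0.trans hb.1, hb.2⟩, hb'⟩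
    linarith [hb.1]
  · exact fun t ht => hlt t ⟨ht.1, ht.2.trans_le hR⟩

theorem pos_of_ne_zero (S : RadialSystem α ε lam R J G P Q) (hne : ∃ t ∈ Ioo 0 R, J t ≠ 0) {r : ℝ}
    (hr : r ∈ Ioo 0 R) (hsm : IsSmall ε lam r) : 0 < J r := by
  refine (S.nonneg_J r hr).lt_of_ne' fun h => ?_
  obtain ⟨t, ht, hJt⟩ := hne
  refine hJt (S.eq_zero_of_eq_zero_ball hr (S.eq_zero_inward le_rfl hr.1 hr.2 ?_ ?_ h) t ht)
  · simp [ballInt]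
  · simpa using hsm

/-- Upper bound of the normalized frequency by its value at a larger radius. -/
theorem normFreq_le (S : RadialSystem α ε lam R J G P Q) {r b : ℝ} (hr : 0 < r) (hrb : r ≤ b)
    (hbR : b < R) (hsm : IsSmall ε lam b) (hJ : ∀ t ∈ Ioc 0 b, 0 < J t) :
    normFreq ε J G r ≤ monoFreq ε lam J G b :=
  (normFreq_le_monoFreq S.eps_pos hr.le).trans
    (S.monotoneOn_monoFreq le_rfl hbR (by simp [ballInt]) (by simpa using hsm) hJ
      ⟨hr, hrb⟩ ⟨hr.trans_le hrb, le_rfl⟩ hrb)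

/-! ### The normalized frequency tends to a nonpositive limit at the tip -/

/-- If the normalized frequency stays above `L > 0`, then the integral of `uᵣ²` over `B_r`
is at least a fixed part of the boundary term in Green's formula. -/
theorem ballInt_P_lower (S : RadialSystem α ε lam R J G P Q) {b L : ℝ} (hb : b ∈ Ioo 0 R)
    (hL : 0 < L) (hJ : ∀ t ∈ Ioc 0 b, 0 < J t) (hV : ∀ t ∈ Ioc 0 b, L ≤ normFreq ε J G t)
    (hsmall : ∀ t ∈ Ioc 0 b, |α - 1 - 2 * ε| * t ^ (2 * ε) ≤ 2 * L) :
    L / 4 * b ^ (α - 1 - 2 * ε) * J b ≤ ballInt α P b := by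
  have hsub : Ioc 0 b ⊆ Ioo 0 R := fun x hx => ⟨hx.1, hx.2.trans_lt hb.2⟩
  have hLJ : ∀ t ∈ Ioc 0 b, L * J t ≤ t ^ (2 * ε + 1) * G t := fun t ht =>
    (le_div_iff₀ (hJ t ht)).1 (hV t ht)
  set q := α - 1 - 2 * ε with hq
  have eq1 : ∀ t ∈ Ioc 0 b, t ^ q * t ^ (2 * ε + 1) = t ^ α := fun t ht => by
    rw [← Real.rpow_add ht.1]; congr 1; rw [hq]; ring
  have hmono : MonotoneOn (fun t => ballInt α P t - L / 4 * (t ^ q * J t)) (Ioc 0 b) := by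
    refine monotoneOn_of_hasDerivAt_nonneg (convex_Ioc 0 b)
      (f' := fun t => t ^ α * P t - L / 4 * (q * t ^ (q - 1) * J t + t ^ q * (2 * G t)))
      (fun t ht => ?_) fun t ht => ?_
    · exact (hasDerivAt_ballInt S.cont_P (S.integrable_P (hsub ht)) (hsub ht)).sub
        (((Real.hasDerivAt_rpow_const (Or.inl ht.1.ne')).mul
          (S.hasDerivAt_J t (hsub ht))).const_mul _)
    · have hJt := hJ t ht
      have ht0 := ht.1
      have hp := Real.rpow_pos_of_pos ht0 q
      have hp1 := Real.rpow_pos_of_pos ht0 (2 * ε)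
      have e1 : t ^ (2 * ε + 1) = t ^ (2 * ε) * t := Real.rpow_add_one ht0.ne' _
      have e2 : t ^ q = t ^ (q - 1) * t := by rw [← Real.rpow_add_one ht0.ne']; ring_nf
      have h1 := hLJ t ht
      have h2 := hsmall t ht
      have hcs := S.cauchySchwarz t (hsub ht)
      have hp2 := Real.rpow_pos_of_pos ht0 (q - 1)
      have hG : 0 < G t := by
        have : 0 < t ^ (2 * ε + 1) * G t := lt_of_lt_of_le (mul_pos hL hJt) h1
        exact (pos_iff_pos_of_mul_pos this).1 (by positivity)
      rw [← eq1 t ht, e1, e2]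
      rw [e1] at h1
      generalize t ^ (q - 1) = c at *
      generalize t ^ (2 * ε) = a at *
      -- `t^{2ε+1} P ≥ t^{2ε+1} G² / J ≥ L G`
      have h3 : L * G t ≤ a * t * P t := by
        have : L * G t * J t ≤ a * t * P t * J t := by
          calc L * G t * J t = G t * (L * J t) := by ring
            _ ≤ G t * (a * t * G t) := by gcongr
            _ = a * t * G t ^ 2 := by ring
            _ ≤ a * t * (P t * J t) := by gcongr
            _ = _ := by ring
        exact le_of_mul_le_mul_right this hJt
      have h4 : L * (q * J t) ≤ 2 * L * (t * G t) := by
        calc L * (q * J t) ≤ |q| * (L * J t) := by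
              have := mul_le_mul_of_nonneg_right (le_abs_self q) (mul_pos hL hJt).le
              linarith
          _ ≤ |q| * (a * t * G t) := by gcongr
          _ = |q| * a * (t * G t) := by ring
          _ ≤ 2 * L * (t * G t) := by gcongr
      have h5 : 0 ≤ t * (a * t * P t) - 1 / 4 * (L * (q * J t)) - L / 2 * (t * G t) := by
        nlinarith
      have := mul_nonneg hp2.le h5
      linarith
  have hlim : Tendsto (fun t => -(1 / 4) * (t ^ α * G t)) (𝓝[>] 0) (𝓝 (-(1 / 4) * 0)) := by
    refine Tendsto.const_mul _ ?_
    have h1 : Tendsto (fun t => ballInt α P t + ballInt α Q t + lam * ballInt α J t) (𝓝[>] 0)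
        (𝓝 (ballInt α P 0 + ballInt α Q 0 + lam * ballInt α J 0)) :=
      ((tendsto_primitive (S.integrable_P hb) le_rfl hb.1).add
        (tendsto_primitive (S.integrable_Q hb) le_rfl hb.1)).add
        ((tendsto_primitive (S.integrable_J hb) le_rfl hb.1).const_mul _)
    have e : ballInt α P 0 + ballInt α Q 0 + lam * ballInt α J 0 = 0 := by simp [ballInt]
    rw [e] at h1
    refine h1.congr' ?_
    filter_upwards [Ioo_mem_nhdsGT hb.1] with t ht using
      (S.green (hsub ⟨ht.1, ht.2.le⟩)).symm
  have hlow : ∀ᶠ t in 𝓝[>] (0 : ℝ), -(1 / 4) * (t ^ α * G t) ≤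
      ballInt α P b - L / 4 * (b ^ q * J b) := by
    filter_upwards [Ioo_mem_nhdsGT hb.1] with t ht
    have ht' : t ∈ Ioc 0 b := ⟨ht.1, ht.2.le⟩
    refine le_trans ?_ (hmono ht' ⟨hb.1, le_rfl⟩ ht.2.le)
    have h1 : 0 ≤ ballInt α P t := ballInt_nonneg S.nonneg_P (hsub ht')
    have h2 := mul_le_mul_of_nonneg_left (hLJ t ht') (Real.rpow_nonneg ht.1.le q)
    rw [← mul_assoc _ _ (G t), eq1 t ht'] at h2
    simp only
    linarith
  have := le_of_tendsto hlim hlow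
  linarith

/-- The normalized frequency becomes arbitrarily small at the tip: otherwise its derivative would
be at least `c / r`, and it would be unbounded below. -/
theorem eventually_normFreq_le (S : RadialSystem α ε lam R J G P Q) {b δ : ℝ} (hb : b ∈ Ioo 0 R)
    (hsm : IsSmall ε lam b) (hJ : ∀ t ∈ Ioc 0 b, 0 < J t) (hδ : 0 < δ) :
    ∃ a ∈ Ioc 0 b, ∀ t ∈ Ioc 0 a, normFreq ε J G t ≤ δ := by
  have hε := S.eps_pos
  by_contra! hcon
  have hmono := S.monotoneOn_monoFreq le_rfl hb.2 (by simp [ballInt]) (by simpa using hsm) hJ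
  have hW : ∀ t ∈ Ioc 0 b, δ ≤ monoFreq ε lam J G t := by
    intro t ht
    obtain ⟨x, hx, hx'⟩ := hcon t ht
    have hxb : x ∈ Ioc 0 b := ⟨hx.1, hx.2.trans ht.2⟩
    exact hx'.le.trans ((normFreq_le_monoFreq hε hx.1.le).trans (hmono hxb ht hx.2))
  set C := errConst ε lam / (2 * ε + 2) with hC
  have hC0 : 0 ≤ C := by
    have := errConst_nonneg (lam := lam) hε
    positivity
  set q := α - 1 - 2 * ε with hq
  have hlim : ∀ c p y : ℝ, 0 < p → 0 < y → ∀ᶠ t in 𝓝[>] (0 : ℝ), c * t ^ p ≤ y := by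
    intro c p y hp hy
    have h1 : Tendsto (fun t : ℝ => c * t ^ p) (𝓝[>] 0) (𝓝 (c * 0 ^ p)) :=
      (((Real.continuousAt_rpow_const 0 p (Or.inr hp.le)).const_mul c).tendsto).mono_left
        nhdsWithin_le_nhds
    rw [Real.zero_rpow hp.ne', mul_zero] at h1
    exact h1.eventually (ge_mem_nhds hy)
  have hev := (hlim C (2 * ε + 2) (δ / 2) (by positivity) (by positivity)).and
    (hlim |q| (2 * ε) (2 * (δ / 2)) (by positivity) (by positivity))
  obtain ⟨y, hy0, hy⟩ := mem_nhdsGT_iff_exists_Ioo_subset.1 hev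
  obtain ⟨a, ha0, ha⟩ : ∃ a, 0 < a ∧ a < min y b := exists_between (lt_min hy0 hb.1)
  have hab : Ioc 0 a ⊆ Ioc 0 b := fun t ht => ⟨ht.1, ht.2.trans (ha.le.trans (min_le_right _ _))⟩
  have haR : ∀ t ∈ Ioc 0 a, t ∈ Ioo 0 R := fun t ht => ⟨ht.1, (hab ht).2.trans_lt hb.2⟩
  have hay : ∀ t ∈ Ioc 0 a, t ∈ Ioo 0 y := fun t ht =>
    ⟨ht.1, ht.2.trans_lt (ha.trans_le (min_le_left _ _))⟩
  have hV : ∀ t ∈ Ioc 0 a, δ / 2 ≤ normFreq ε J G t := fun t ht => by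
    have h1 := hW t (hab ht)
    have h2 := (hy (hay t ht)).1
    unfold monoFreq at h1
    linarith
  set k := ε * (δ / 2 / 4) with hk
  have hk0 : 0 < k := by positivity
  have hder : ∀ t ∈ Ioc 0 a, ∃ W', HasDerivAt (monoFreq ε lam J G) W' t ∧ k / t ≤ W' := by
    intro t ht
    obtain ⟨W', h1, h2⟩ := S.hasDerivAt_monoFreq le_rfl ht.1 (haR t ht).2 (by simp [ballInt])
      (hsm.mono hε (by linarith [ht.1]) (by linarith [(hab ht).2])) (hJ t (hab ht))
    refine ⟨W', h1, le_trans ?_ h2⟩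
    have h3 := S.ballInt_P_lower (haR t ht) (half_pos hδ)
      (fun x hx => hJ x (hab ⟨hx.1, hx.2.trans ht.2⟩))
      (fun x hx => hV x ⟨hx.1, hx.2.trans ht.2⟩)
      (fun x hx => (hy (hay x ⟨hx.1, hx.2.trans ht.2⟩)).2)
    have hJt := hJ t (hab ht)
    have ht0 := ht.1
    have e : t ^ (2 * ε - α) * t ^ q = t⁻¹ := by
      rw [← Real.rpow_add ht0, ← Real.rpow_neg_one]; congr 1; rw [hq]; ring
    rw [le_div_iff₀ hJt]
    calc k / t * J t = ε * t ^ (2 * ε - α) * (δ / 2 / 4 * t ^ q * J t) := by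
          rw [hk, div_eq_mul_inv, ← e]; ring
      _ ≤ _ := by gcongr
  choose! W' h1 h2 using hder
  have hmono2 : MonotoneOn (fun t => monoFreq ε lam J G t - k * Real.log t) (Ioc 0 a) := by
    refine monotoneOn_of_hasDerivAt_nonneg (convex_Ioc 0 a) (f' := fun t => W' t - k * t⁻¹)
      (fun t ht => (h1 t ht).sub ((Real.hasDerivAt_log ht.1.ne').const_mul _)) fun t ht => ?_
    have := h2 t ht
    rw [div_eq_mul_inv] at this
    linarith
  -- at `a e^{-M}` the logarithm has used up the whole value of the frequency at `a`
  set M := monoFreq ε lam J G a / k with hM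
  have hM0 : 0 < M := div_pos (hδ.trans_le (hW a (hab ⟨ha0, le_rfl⟩))) hk0
  have hta : a * Real.exp (-M) ≤ a := by
    have : Real.exp (-M) ≤ 1 := Real.exp_le_one_iff.2 (by linarith)
    nlinarith
  have hmem : a * Real.exp (-M) ∈ Ioc 0 a := ⟨by positivity, hta⟩
  have h3 := hmono2 hmem ⟨ha0, le_rfl⟩ hta
  have h4 := hW _ (hab hmem)
  simp only at h3
  rw [Real.log_mul ha0.ne' (Real.exp_pos _).ne', Real.log_exp] at h3
  have h5 : k * M = monoFreq ε lam J G a := by rw [hM]; field_simp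
  linarith

/-- Strong unique continuation for the radial system: the normalized frequency is eventually at most
`ε c / 2`, so a nonzero `J` decays at most like `e^{-(c/2) r^{-2ε}}`. -/
theorem eq_zero_of_decay (S : RadialSystem α ε lam R J G P Q) {b M c : ℝ} (hb : b ∈ Ioo 0 R)
    (hc : 0 < c) (hdecay : ∀ t ∈ Ioc 0 b, J t ≤ M * Real.exp (-c * t ^ (-2 * ε))) :
    ∀ t ∈ Ioo 0 R, J t = 0 := by
  have hε := S.eps_pos
  by_contra! hne
  obtain ⟨d, hd, hsm⟩ := exists_isSmall (ε := ε) (lam := lam) hε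
  set b' := min b d with hb'
  have hb'0 : 0 < b' := lt_min hb.1 hd
  have hb'R : b' ∈ Ioo 0 R := ⟨hb'0, (min_le_left _ _).trans_lt hb.2⟩
  have hsm' : IsSmall ε lam b' := hsm.mono hε hb'0.le (min_le_right _ _)
  have hpos : ∀ t ∈ Ioc 0 b', 0 < J t := fun t ht =>
    S.pos_of_ne_zero hne ⟨ht.1, ht.2.trans_lt hb'R.2⟩ (hsm'.mono hε ht.1.le ht.2)
  obtain ⟨a, ha, hV⟩ := S.eventually_normFreq_le hb'R hsm' hpos
    (show 0 < ε * (c / 2) by positivity)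
  have hle : ∀ t ∈ Ioc 0 a, J a ≤ M * Real.exp (-(c / 2 * t ^ (-2 * ε))) := by
    intro t ht
    have h1 := S.log_lower_bound ht.1 ht.2 (ha.2.trans_lt hb'R.2)
      (show 0 ≤ ε * (c / 2) by positivity)
      (fun x hx => hpos x ⟨ht.1.trans_le hx.1, hx.2.trans ha.2⟩)
      (fun x hx => hV x ⟨ht.1.trans_le hx.1, hx.2⟩)
    have h2 := hdecay t ⟨ht.1, ht.2.trans (ha.2.trans (min_le_left _ _))⟩
    rw [mul_div_cancel_left₀ _ hε.ne'] at h1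
    have h3 := h1.trans h2
    have e : Real.exp (-c * t ^ (-2 * ε)) =
        Real.exp (-(c / 2 * t ^ (-2 * ε))) * Real.exp (-(c / 2 * t ^ (-2 * ε))) := by
      rw [← Real.exp_add]; ring_nf
    rw [e, ← mul_assoc] at h3
    exact le_of_mul_le_mul_right h3 (Real.exp_pos _)
  have hlim : Tendsto (fun t : ℝ => M * Real.exp (-(c / 2 * t ^ (-2 * ε)))) (𝓝[>] 0)
      (𝓝 (M * 0)) := by
    refine Tendsto.const_mul _ (Real.tendsto_exp_atBot.comp ?_)
    refine tendsto_neg_atTop_atBot.comp (Tendsto.const_mul_atTop (by positivity) ?_)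
    exact tendsto_rpow_neg_nhdsGT_zero (by linarith)
  have hfin := ge_of_tendsto hlim (by
    filter_upwards [Ioo_mem_nhdsGT ha.1] with t ht using hle t ⟨ht.1, ht.2.le⟩)
  have := hpos a ha
  linarith

end RadialSystem

open Metric

/-! ### Polar coordinates -/

variable {n : ℕ}

/-- The integral of `F` over the sphere of radius `r`, with respect to the measure of the unit
sphere. -/
noncomputable def sphInt (F : E n → ℝ) (r : ℝ) : ℝ :=
  ∫ ω : sphere (0 : E n) 1, F (r • (ω : E n)) ∂(volume : Measure (E n)).toSphere

theorem nontrivial_E (hn : 1 ≤ n) : Nontrivial (E n) := by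
  obtain ⟨m, rfl⟩ : ∃ m, n = m + 1 := ⟨n - 1, by omega⟩
  infer_instance

theorem integral_polar (hn : 1 ≤ n) {F : E n → ℝ} (hF : Integrable F) :
    IntegrableOn (fun r => r ^ (n - 1) * sphInt F r) (Ioi 0) ∧
      ∫ x, F x = ∫ r in Ioi (0 : ℝ), r ^ (n - 1) * sphInt F r := by
  have := nontrivial_E hn
  set μ : Measure (E n) := volume
  have hmp := μ.measurePreserving_homeomorphUnitSphereProd
  have hemb := (homeomorphUnitSphereProd (E n)).measurableEmbedding
  have hdim : Module.finrank ℝ (E n) - 1 = n - 1 := by simp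
  rw [hdim] at hmp
  set Fp : sphere (0 : E n) 1 × Ioi (0 : ℝ) → ℝ := fun p => F ((p.2 : ℝ) • (p.1 : E n)) with hFp
  have hcomp : Fp ∘ homeomorphUnitSphereProd (E n) = F ∘ Subtype.val := by
    funext x
    simp only [hFp, Function.comp]
    rw [← homeomorphUnitSphereProd_symm_apply_coe, Homeomorph.symm_apply_apply]
  have hFp_int : Integrable Fp (μ.toSphere.prod (Measure.volumeIoiPow (n - 1))) := by
    rw [← hmp.integrable_comp_emb hemb, hcomp,
      ← integrableOn_iff_comap_subtypeVal (measurableSet_singleton (0 : E n)).compl]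
    exact hF.integrableOn
  have hmeas : Measurable fun r : Ioi (0 : ℝ) => Real.toNNReal ((r : ℝ) ^ (n - 1)) :=
    (measurable_subtype_coe.pow_const _).real_toNNReal
  have hcoe : ∀ r : ℝ, 0 < r → (Real.toNNReal (r ^ (n - 1)) • sphInt F r) =
      r ^ (n - 1) * sphInt F r := fun r hr => by
    rw [NNReal.smul_def, Real.coe_toNNReal _ (pow_nonneg hr.le _), smul_eq_mul]
  constructor
  · have h1 : Integrable (fun r : Ioi (0 : ℝ) => sphInt F r) (Measure.volumeIoiPow (n - 1)) :=
      hFp_int.integral_prod_right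
    rw [Measure.volumeIoiPow] at h1
    have h2 := (integrable_withDensity_iff_integrable_smul hmeas).1 h1
    rw [integrableOn_iff_comap_subtypeVal measurableSet_Ioi]
    refine h2.congr (ae_of_all _ fun r => ?_)
    exact hcoe r r.2
  · calc ∫ x, F x = ∫ x : ({(0)}ᶜ : Set (E n)), F x ∂(μ.comap (↑)) := by
          rw [integral_subtype_comap (measurableSet_singleton _).compl F, restrict_compl_singleton]
      _ = ∫ p, Fp p ∂(μ.toSphere.prod (Measure.volumeIoiPow (n - 1))) := by
          rw [← hmp.integral_comp hemb]
          exact integral_congr_ae (ae_of_all _ fun x => (congrFun hcomp x).symm)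
      _ = ∫ r : Ioi (0 : ℝ), sphInt F r ∂(Measure.volumeIoiPow (n - 1)) :=
          integral_prod_symm _ hFp_int
      _ = _ := by
          rw [Measure.volumeIoiPow]
          refine (integral_withDensity_eq_integral_smul hmeas _).trans ?_
          rw [integral_subtype_comap measurableSet_Ioi
            fun r : ℝ => Real.toNNReal (r ^ (n - 1)) • sphInt F r]
          exact setIntegral_congr_fun measurableSet_Ioi fun r hr => hcoe r hr

theorem norm_smul_sphere {r : ℝ} (hr : 0 < r) (ω : sphere (0 : E n) 1) :
    ‖r • (ω : E n)‖ = r := by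
  rw [norm_smul, Real.norm_eq_abs, abs_of_pos hr, norm_eq_of_mem_sphere, mul_one]

theorem angle_smul_sphere {r : ℝ} (hr : 0 < r) (ω : sphere (0 : E n) 1) :
    angle (r • (ω : E n)) = ω := by
  rw [angle, norm_smul_sphere hr, smul_smul, inv_mul_cancel₀ hr.ne', one_smul]

theorem smul_sphere_mem {r R : ℝ} (hr : r ∈ Ioo 0 R) (ω : sphere (0 : E n) 1) :
    r • (ω : E n) ∈ ball (0 : E n) R \ {0} := by
  refine ⟨?_, ?_⟩
  · rw [mem_ball_zero_iff, norm_smul_sphere hr.1]; exact hr.2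
  · rw [mem_singleton_iff, ← norm_eq_zero, norm_smul_sphere hr.1]; exact hr.1.ne'

theorem sphInt_congr {F H : E n → ℝ} {r : ℝ} (h : ∀ x : E n, ‖x‖ = r → F x = H x) (hr : 0 < r) :
    sphInt F r = sphInt H r :=
  integral_congr_ae (ae_of_all _ fun ω => h _ (norm_smul_sphere hr ω))

theorem integral_ball_polar (hn : 1 ≤ n) {F : E n → ℝ} {R : ℝ} (hR : 0 < R)
    (hF : IntegrableOn F (ball 0 R)) :
    IntervalIntegrable (fun r => r ^ (n - 1) * sphInt F r) volume 0 R ∧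
      ∫ x in ball 0 R, F x = ∫ r in (0 : ℝ)..R, r ^ (n - 1) * sphInt F r := by
  have h := integral_polar hn (hF.integrable_indicator measurableSet_ball)
  have hs : ∀ r ∈ Ioi (0 : ℝ), r ^ (n - 1) * sphInt ((ball 0 R).indicator F) r =
      (Iio R).indicator (fun r => r ^ (n - 1) * sphInt F r) r := by
    intro r hr
    by_cases hrR : r < R
    · rw [indicator_of_mem (by exact hrR)]
      congr 1
      refine sphInt_congr (fun x hx => indicator_of_mem ?_ _) hr
      rw [mem_ball_zero_iff, hx]; exact hrR
    · rw [indicator_of_notMem (by exact hrR)]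
      rw [sphInt_congr (H := 0) (fun x hx => indicator_of_notMem ?_ _) hr]
      · simp [sphInt]
      · rw [mem_ball_zero_iff, hx]; exact hrR
  have h1 := h.1.congr_fun hs measurableSet_Ioi
  have h2 := h.2.trans (setIntegral_congr_fun measurableSet_Ioi hs)
  rw [integral_indicator measurableSet_ball] at h2
  rw [setIntegral_indicator measurableSet_Iio, Ioi_inter_Iio] at h2
  rw [integrableOn_indicator_iff measurableSet_Iio, inter_comm, Ioi_inter_Iio] at h1
  constructor
  · rw [intervalIntegrable_iff_integrableOn_Ioo_of_le hR.le]
    exact h1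
  · rw [h2, intervalIntegral.integral_of_le hR.le, integral_Ioc_eq_integral_Ioo]

/-! ### Spherical integrals depending on the radius -/

theorem continuousOn_sphere_comp {F : Type*} [TopologicalSpace F] {H : E n → F} {R : ℝ}
    (hH : ContinuousOn H (ball 0 R \ {0})) :
    ContinuousOn (fun p : ℝ × sphere (0 : E n) 1 => H (p.1 • (p.2 : E n))) (Ioo 0 R ×ˢ univ) :=
  hH.comp (by fun_prop) fun p hp => smul_sphere_mem hp.1 p.2

theorem continuousOn_sphInt {F : E n → ℝ} {R : ℝ} (hF : ContinuousOn F (ball 0 R \ {0})) :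
    ContinuousOn (sphInt F) (Ioo 0 R) :=
  continuousOn_integral_of_compact_support (k := univ) isCompact_univ
    (f := fun (r : ℝ) (ω : sphere (0 : E n) 1) => F (r • (ω : E n)))
    (continuousOn_sphere_comp hF) fun _ ω _ h => absurd (mem_univ ω) h

theorem continuous_sphere_slice {F : E n → ℝ} {R r : ℝ} (hF : ContinuousOn F (ball 0 R \ {0}))
    (hr : r ∈ Ioo 0 R) : Continuous fun ω : sphere (0 : E n) 1 => F (r • (ω : E n)) :=
  hF.comp_continuous (by fun_prop) fun ω => smul_sphere_mem hr ω

theorem integrable_sphere_slice {F : E n → ℝ} {R r : ℝ} (hF : ContinuousOn F (ball 0 R \ {0}))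
    (hr : r ∈ Ioo 0 R) : Integrable (fun ω : sphere (0 : E n) 1 => F (r • (ω : E n)))
      (volume : Measure (E n)).toSphere :=
  (continuous_sphere_slice hF hr).integrable_of_hasCompactSupport
    (HasCompactSupport.of_compactSpace _)

theorem isOpen_punctured {R : ℝ} : IsOpen (ball (0 : E n) R \ {0}) :=
  isOpen_ball.sdiff isClosed_singleton

theorem continuousOn_angle {R : ℝ} : ContinuousOn (angle : E n → E n) (ball 0 R \ {0}) :=
  (continuous_norm.continuousOn.inv₀ fun _ hx => norm_ne_zero_iff.2 hx.2).smul continuousOn_id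

theorem continuousOn_fderiv_angle {F : E n → ℝ} {R : ℝ} (hF : ContDiffOn ℝ 1 F (ball 0 R \ {0})) :
    ContinuousOn (fun x => fderiv ℝ F x (angle x)) (ball 0 R \ {0}) :=
  (hF.continuousOn_fderiv_of_isOpen isOpen_punctured le_rfl).clm_apply continuousOn_angle

theorem hasDerivAt_sphInt {F : E n → ℝ} {R r : ℝ} (hF : ContDiffOn ℝ 1 F (ball 0 R \ {0}))
    (hr : r ∈ Ioo 0 R) :
    HasDerivAt (sphInt F) (sphInt (fun x => fderiv ℝ F x (angle x)) r) r := by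
  have hc := continuousOn_fderiv_angle hF
  obtain ⟨a, ha, har⟩ := exists_between hr.1
  obtain ⟨b, hrb, hb⟩ := exists_between hr.2
  have hsub : Icc a b ⊆ Ioo 0 R := fun x hx => ⟨ha.trans_le hx.1, hx.2.trans_lt hb⟩
  have hK : IsCompact (Icc a b ×ˢ (univ : Set (sphere (0 : E n) 1))) :=
    isCompact_Icc.prod isCompact_univ
  obtain ⟨C, hC⟩ := hK.exists_bound_of_continuousOn
    ((continuousOn_sphere_comp hc).mono (prod_mono hsub subset_rfl))
  refine (hasDerivAt_integral_of_dominated_loc_of_deriv_le (s := Icc a b)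
    (bound := fun _ => C) (F := fun (r : ℝ) (ω : sphere (0 : E n) 1) => F (r • (ω : E n)))
    (F' := fun (r : ℝ) (ω : sphere (0 : E n) 1) =>
      fderiv ℝ F (r • (ω : E n)) (angle (r • (ω : E n))))
    (Icc_mem_nhds har hrb) ?_ (integrable_sphere_slice hF.continuousOn hr)
    (continuous_sphere_slice hc hr).aestronglyMeasurable ?_ (integrable_const C) ?_).2
  · filter_upwards [isOpen_Ioo.mem_nhds hr] with t ht
    exact (continuous_sphere_slice hF.continuousOn ht).aestronglyMeasurable
  · exact ae_of_all _ fun ω t ht => hC (t, ω) ⟨ht, mem_univ _⟩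
  · refine ae_of_all _ fun ω t ht => ?_
    have ht' := hsub ht
    have hx := smul_sphere_mem ht' ω
    have h1 : HasFDerivAt F (fderiv ℝ F (t • (ω : E n))) (t • (ω : E n)) :=
      ((hF.contDiffAt (isOpen_punctured.mem_nhds hx)).differentiableAt (by simp)).hasFDerivAt
    have h2 : HasDerivAt (fun t : ℝ => t • (ω : E n)) ((1 : ℝ) • (ω : E n)) t :=
      (hasDerivAt_id t).smul_const _
    rw [angle_smul_sphere ht'.1]
    have h3 := h1.comp_hasDerivAt t h2
    rw [one_smul] at h3
    exact h3

/-! ### The divergence theorem on spheres -/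

theorem div_smul {φ : E n → ℝ} {X : E n → E n} {x : E n} (hφ : DifferentiableAt ℝ φ x)
    (hX : DifferentiableAt ℝ X x) :
    div (fun y => φ y • X y) x = φ x * div X x + fderiv ℝ φ x (X x) := by
  have h1 : fderiv ℝ (fun y => φ y • X y) x = _ := (hφ.hasFDerivAt.smul hX.hasFDerivAt).fderiv
  have h2 : X x = ∑ i, X x i • EuclideanSpace.single i (1 : ℝ) := by
    ext j; simp [Pi.single_apply]
  unfold div
  rw [h1]
  conv_rhs => rw [h2, map_sum]
  simp [Finset.sum_add_distrib, Finset.mul_sum, mul_comm]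

theorem continuousOn_div {X : E n → E n} {U : Set (E n)} (hU : IsOpen U)
    (hX : ContDiffOn ℝ 1 X U) : ContinuousOn (div X) U := by
  have h := hX.continuousOn_fderiv_of_isOpen hU le_rfl
  unfold div
  refine continuousOn_finsetSum _ fun i _ => ?_
  exact (EuclideanSpace.proj (𝕜 := ℝ) i).continuous.comp_continuousOn
    (h.clm_apply continuousOn_const)

theorem integral_div_eq_zero {X : E n → E n} (hX : ContDiff ℝ 1 X) (hs : HasCompactSupport X) :
    Integrable (div X) ∧ ∫ x, div X x = 0 := by
  have hint : ∀ v, Integrable fun x => fderiv ℝ X x v := fun v =>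
    ((hX.continuous_fderiv one_ne_zero).clm_apply continuous_const).integrable_of_hasCompactSupport
      (hs.fderiv_apply (𝕜 := ℝ) v)
  have hzero : ∀ v, ∫ x, fderiv ℝ X x v = 0 := by
    intro v
    have h := integral_smul_fderiv_eq_neg_fderiv_smul_of_integrable (μ := (volume : Measure (E n)))
      (f := fun _ : E n => (1 : ℝ)) (g := X) (v := v) (by simp) (by simpa using hint v)
      (by simpa using hX.continuous.integrable_of_hasCompactSupport hs)
      (fun x _ => differentiableAt_const _)
      (fun x _ => (hX.differentiable (by simp)).differentiableAt)
    simpa using h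
  have hint' : ∀ i : Fin n, Integrable fun x => fderiv ℝ X x (EuclideanSpace.single i 1) i :=
    fun i => (EuclideanSpace.proj (𝕜 := ℝ) i).integrable_comp (hint _)
  refine ⟨integrable_finsetSum _ fun i _ => hint' i, ?_⟩
  unfold div
  rw [integral_finsetSum _ fun i _ => hint' i]
  refine Finset.sum_eq_zero fun i _ => ?_
  refine ((EuclideanSpace.proj (𝕜 := ℝ) i).integral_comp_comm
    (hint (EuclideanSpace.single i 1))).trans ?_
  rw [hzero, map_zero]

theorem fderiv_comp_norm {φ : ℝ → ℝ} {x : E n} (hx : x ≠ 0) (hφ : DifferentiableAt ℝ φ ‖x‖)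
    (v : E n) : fderiv ℝ (fun y => φ ‖y‖) x v = deriv φ ‖x‖ * inner ℝ (angle x) v := by
  have h2 : DifferentiableAt ℝ (fun y : E n => ‖y‖) x :=
    (contDiffAt_norm ℝ hx (n := 1)).differentiableAt (by simp)
  have h := (hφ.hasDerivAt.comp_hasFDerivAt x h2.hasFDerivAt).fderiv
  have h' : fderiv ℝ (fun y => φ ‖y‖) x = _ := h
  rw [h']
  simp [fderiv_norm hx]

/-- The divergence theorem on annuli, in differentiated form: the flux through the sphere of radius
`r` has the derivative `r^{n-1} ∫ div X`. The flux is differentiable, and the weak form of the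
identity holds because `div (φ(|x|) X)` has integral zero for test functions `φ`. -/
theorem hasDerivAt_flux (hn : 1 ≤ n) {X : E n → E n} {R r : ℝ}
    (hX : ContDiffOn ℝ 1 X (ball 0 R \ {0})) (hr : r ∈ Ioo 0 R) :
    HasDerivAt (fun t => t ^ (n - 1) * sphInt (fun x => inner ℝ (angle x) (X x)) t)
      (r ^ (n - 1) * sphInt (div X) r) r := by
  have hang : ContDiffOn ℝ 1 (angle : E n → E n) (ball 0 R \ {0}) := fun x hx =>
    (((contDiffAt_norm ℝ hx.2).inv (norm_ne_zero_iff.2 hx.2)).smul contDiffAt_id).contDiffWithinAt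
  have hrad : ContDiffOn ℝ 1 (fun x => inner ℝ (angle x) (X x)) (ball 0 R \ {0}) :=
    hang.inner ℝ hX
  set H : ℝ → ℝ := fun t => t ^ (n - 1) * sphInt (fun x => inner ℝ (angle x) (X x)) t with hH
  set H' : ℝ → ℝ := fun t => ((n - 1 : ℕ) : ℝ) * t ^ (n - 1 - 1) *
      sphInt (fun x => inner ℝ (angle x) (X x)) t + t ^ (n - 1) *
      sphInt (fun x => fderiv ℝ (fun x => inner ℝ (angle x) (X x)) x (angle x)) t with hH'
  set k : ℝ → ℝ := fun t => t ^ (n - 1) * sphInt (div X) t with hk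
  have hder : ∀ t ∈ Ioo 0 R, HasDerivAt H (H' t) t := fun t ht =>
    (hasDerivAt_pow (n - 1) t).mul (hasDerivAt_sphInt hrad ht)
  have hH'c : ContinuousOn H' (Ioo 0 R) := by
    refine ((by fun_prop : ContinuousOn (fun t : ℝ => ((n - 1 : ℕ) : ℝ) * t ^ (n - 1 - 1))
      (Ioo 0 R)).mul (continuousOn_sphInt hrad.continuousOn)).add
      ((continuous_pow _).continuousOn.mul (continuousOn_sphInt (continuousOn_fderiv_angle hrad)))
  have hHc : ContinuousOn H (Ioo 0 R) := fun t ht => (hder t ht).continuousAt.continuousWithinAt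
  have hdivc := continuousOn_div isOpen_punctured hX
  have hkc : ContinuousOn k (Ioo 0 R) :=
    (continuous_pow _).continuousOn.mul (continuousOn_sphInt hdivc)
  suffices h : EqOn (fun t => k t - H' t) (fun _ => 0) (Ioo 0 R) by
    have := h hr
    simp only [sub_eq_zero] at this
    have h2 := hder r hr
    rwa [← this] at h2
  refine Measure.eqOn_open_of_ae_eq (μ := volume) ?_ isOpen_Ioo (hkc.sub hH'c) continuousOn_const
  rw [EventuallyEq, ae_restrict_iff' measurableSet_Ioo]
  refine isOpen_Ioo.ae_eq_zero_of_integral_contDiff_smul_eq_zero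
    ((hkc.sub hH'c).locallyIntegrableOn measurableSet_Ioo) fun φ hφ hφc hφs => ?_
  have hφ0 : ∀ t, t ∉ Ioo 0 R → φ t = 0 := fun t ht =>
    image_eq_zero_of_notMem_tsupport fun h => ht (hφs h)
  have hφ'0 : ∀ t, t ∉ Ioo 0 R → deriv φ t = 0 := fun t ht =>
    image_eq_zero_of_notMem_tsupport fun h => ht (hφs (tsupport_deriv_subset h))
  have hφd : ∀ t, DifferentiableAt ℝ φ t := fun t =>
    (hφ.differentiable (by simp)).differentiableAt
  -- multiplying by a function supported in `tsupport φ` gives continuous, integrable functions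
  have hcont : ∀ (ψ g : ℝ → ℝ), Continuous ψ → tsupport ψ ⊆ tsupport φ →
      ContinuousOn g (Ioo 0 R) → Integrable fun t => ψ t * g t := by
    intro ψ g hψ hψs hg
    have hts : tsupport (fun t => ψ t * g t) ⊆ tsupport ψ := tsupport_mul_subset_left
    refine Continuous.integrable_of_hasCompactSupport ?_
      (hφc.of_isClosed_subset (isClosed_tsupport _) (hts.trans hψs))
    refine continuous_of_tsupport fun t ht => ?_
    have ht' := hφs (hψs (hts ht))
    exact hψ.continuousAt.mul (hg.continuousAt (isOpen_Ioo.mem_nhds ht'))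
  have hφ'cont : Continuous (deriv φ) := hφ.continuous_deriv (by simp)
  have i1 := hcont φ k hφ.continuous subset_rfl hkc
  have i2 := hcont φ H' hφ.continuous subset_rfl hH'c
  have i3 := hcont (deriv φ) H hφ'cont tsupport_deriv_subset hHc
  have i4 := hcont φ H hφ.continuous subset_rfl hHc
  have hline : ∫ t, (deriv φ t * H t + φ t * H' t) = 0 := by
    refine integral_eq_zero_of_hasDerivAt_of_integrable (f := fun t => φ t * H t) (fun t => ?_)
      (i3.add i2) i4
    by_cases ht : t ∈ tsupport φ
    · exact (hφd t).hasDerivAt.mul (hder t (hφs ht))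
    · have hev : (fun t => φ t * H t) =ᶠ[𝓝 t] fun _ => 0 := by
        filter_upwards [notMem_tsupport_iff_eventuallyEq.1 ht] with y hy
        rw [hy]; simp
      have e1 : φ t = 0 := image_eq_zero_of_notMem_tsupport ht
      have e2 : deriv φ t = 0 :=
        image_eq_zero_of_notMem_tsupport fun h => ht (tsupport_deriv_subset h)
      rw [e1, e2]
      simpa using (hasDerivAt_const t (0 : ℝ)).congr_of_eventuallyEq hev
  -- the vector field `φ(|x|) X` on the whole space
  set Y : E n → E n := fun x => φ ‖x‖ • X x with hY
  have hYs : tsupport Y ⊆ (fun x => ‖x‖) ⁻¹' tsupport φ := by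
    refine closure_minimal (fun x hx => subset_tsupport φ ?_)
      ((isClosed_tsupport φ).preimage continuous_norm)
    intro h
    exact hx (by simp [hY, h])
  have hYΩ : ∀ x : E n, ‖x‖ ∈ Ioo 0 R → x ∈ ball (0 : E n) R \ {0} := fun x hx =>
    ⟨mem_ball_zero_iff.2 hx.2, norm_pos_iff.1 hx.1⟩
  have hYd : ContDiff ℝ 1 Y := by
    refine contDiff_iff_contDiffAt.2 fun x => ?_
    by_cases hx : x ∈ tsupport Y
    swap
    · exact contDiffAt_const.congr_of_eventuallyEq (notMem_tsupport_iff_eventuallyEq.1 hx)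
    have hx' := hYΩ x (hφs (hYs hx))
    exact ((hφ.contDiffAt.of_le (by simp)).comp x (contDiffAt_norm ℝ hx'.2)).smul
      (hX.contDiffAt (isOpen_punctured.mem_nhds hx'))
  have hYc : HasCompactSupport Y := by
    refine (isCompact_closedBall (0 : E n) R).of_isClosed_subset (isClosed_tsupport _) ?_
    intro x hx
    exact mem_closedBall_zero_iff.2 (hφs (hYs hx)).2.le
  obtain ⟨hYi, hYz⟩ := integral_div_eq_zero hYd hYc
  rw [(integral_polar hn hYi).2] at hYz
  have hpt : ∀ t ∈ Ioi (0 : ℝ), t ^ (n - 1) * sphInt (div Y) t = deriv φ t * H t + φ t * k t := by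
    intro t ht
    by_cases htR : t ∈ Ioo 0 R
    · have : sphInt (div Y) t = φ t * sphInt (div X) t +
          deriv φ t * sphInt (fun x => inner ℝ (angle x) (X x)) t := by
        unfold sphInt
        rw [← integral_const_mul, ← integral_const_mul, ← integral_add]
        · refine integral_congr_ae (ae_of_all _ fun ω => ?_)
          have hx := smul_sphere_mem htR ω
          have hnr := norm_smul_sphere htR.1 ω
          simp only [hY]
          rw [div_smul (φ := fun y => φ ‖y‖) ((hφd _).comp _ ((contDiffAt_norm ℝ hx.2 (n := 1)).differentiableAt
            (by simp))) ((hX.contDiffAt (isOpen_punctured.mem_nhds hx)).differentiableAt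
            (by simp)), fderiv_comp_norm hx.2 (hφd _), hnr]
        · exact (integrable_sphere_slice hdivc htR).const_mul _
        · exact (integrable_sphere_slice hrad.continuousOn htR).const_mul _
      rw [this]; simp only [hH, hk]; ring
    · rw [hφ0 t htR, hφ'0 t htR, zero_mul, zero_mul, add_zero]
      have : sphInt (div Y) t = 0 := by
        refine integral_eq_zero_of_ae (ae_of_all _ fun ω => ?_)
        have : t • (ω : E n) ∉ tsupport Y := fun h => by
          have := hφs (hYs h)
          simp only [norm_smul_sphere ht] at this
          exact htR this
        have h0 : fderiv ℝ Y (t • (ω : E n)) = 0 :=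
          image_eq_zero_of_notMem_tsupport fun h => this (tsupport_fderiv_subset ℝ h)
        simp [div, h0]
      rw [this, mul_zero]
  rw [setIntegral_congr_fun measurableSet_Ioi hpt,
    setIntegral_eq_integral_of_forall_compl_eq_zero] at hYz
  · have e : ∀ t, φ t • (k t - H' t) =
        (deriv φ t * H t + φ t * k t) - (deriv φ t * H t + φ t * H' t) := fun t => by
      rw [smul_eq_mul]; ring
    simp_rw [e]
    have h := integral_sub (i3.add i1) (i3.add i2)
    simp only [Pi.add_apply] at h
    rw [h, hYz, hline, sub_zero]
  · intro t ht
    have : t ∉ Ioo 0 R := fun h => ht h.1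
    rw [hφ0 t this, hφ'0 t this]; ring

/-! ### Energy density and flux of an eigenfunction -/

/-- The Euler derivative `x · ∇u = r uᵣ`. -/
noncomputable def euler (u : E n → ℝ) (x : E n) : ℝ := fderiv ℝ u x x

/-- The exponent of the density: the weighted volume is `hornCoef n * r^{β} dx` with
`β = hornExp n ε N η`. -/
noncomputable def hornExp (n : ℕ) (ε N η : ℝ) : ℝ := (N - n) * (1 - η) + (n - 1) * ε

/-- The constant factor of the density. -/
noncomputable def hornCoef (n : ℕ) : ℝ := (1 / 2) ^ (n - 1)

/-- The gradient in the horn metric, in explicit form. -/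
noncomputable def vgrad (ε : ℝ) (u : E n → ℝ) (x : E n) : E n :=
  (4 * ‖x‖ ^ (-2 * ε)) • gradient u x +
    ((1 - 4 * ‖x‖ ^ (-2 * ε)) * (euler u x * ‖x‖ ^ (-2 : ℝ))) • x

/-- The square of the gradient in the horn metric, in explicit form. -/
noncomputable def vgradSq (ε : ℝ) (u : E n → ℝ) (x : E n) : ℝ :=
  4 * ‖x‖ ^ (-2 * ε) * ‖gradient u x‖ ^ 2 +
    (1 - 4 * ‖x‖ ^ (-2 * ε)) * (euler u x ^ 2 * ‖x‖ ^ (-2 : ℝ))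

theorem hornCoef_pos : 0 < hornCoef n := by unfold hornCoef; positivity

theorem weight_mul_warp (hn : 1 ≤ n) (ε N η : ℝ) {r : ℝ} (hr : 0 < r) :
    weight n N η r * warp ε r ^ (n - 1) = hornCoef n * r ^ (hornExp n ε N η + (n - 1)) := by
  unfold weight warp hornCoef hornExp
  rw [mul_pow, ← Real.rpow_natCast (r ^ (1 + ε)), ← Real.rpow_mul hr.le, mul_left_comm,
    ← Real.rpow_add hr]
  congr 2
  push_cast [Nat.cast_sub hn]
  ring

theorem density_eq (hn : 1 ≤ n) (ε N η : ℝ) {x : E n} (hx : x ≠ 0) :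
    density n ε N η x = hornCoef n * ‖x‖ ^ hornExp n ε N η := by
  have h0 : 0 < ‖x‖ := norm_pos_iff.2 hx
  rw [density, volDensity_eq hn ε hx, div_pow, ← mul_div_assoc, weight_mul_warp hn ε N η h0,
    Real.rpow_add h0, ← mul_assoc]
  have e : ‖x‖ ^ ((n : ℝ) - 1) = ‖x‖ ^ (n - 1) := by
    rw [← Real.rpow_natCast]; push_cast [Nat.cast_sub hn]; rfl
  rw [e]
  field_simp

theorem conformal_factor (ε : ℝ) {r : ℝ} (hr : 0 < r) :
    (r / warp ε r) ^ 2 = 4 * r ^ (-2 * ε) := by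
  have e : r ^ (-2 * ε) = (r ^ ε)⁻¹ ^ 2 := by
    rw [← Real.rpow_neg hr.le, ← Real.rpow_natCast, ← Real.rpow_mul hr.le]
    congr 1; push_cast; ring
  rw [e, warp, Real.rpow_add hr, Real.rpow_one]
  have := (Real.rpow_pos_of_pos hr ε).ne'
  field_simp
  norm_num

theorem euler_eq (u : E n → ℝ) (x : E n) : euler u x = inner ℝ (gradient u x) x := by
  rw [inner_gradient_left, euler]

theorem inner_angle_gradient (u : E n → ℝ) (x : E n) :
    inner ℝ (angle x) (gradient u x) = euler u x * ‖x‖⁻¹ := by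
  rw [angle, real_inner_smul_left, real_inner_comm, ← euler_eq, mul_comm]

theorem rpow_neg_two {r : ℝ} (hr : 0 < r) : r ^ (-2 : ℝ) = r⁻¹ ^ 2 := by
  rw [Real.rpow_neg hr.le, inv_pow]; norm_num

theorem grad_eq (ε : ℝ) (u : E n → ℝ) {x : E n} (hx : x ≠ 0) : grad ε u x = vgrad ε u x := by
  have h0 : 0 < ‖x‖ := norm_pos_iff.2 hx
  rw [grad, vgrad, conformal_factor ε h0, inner_angle_gradient, rpow_neg_two h0, angle]
  module

theorem fderiv_vgrad (ε : ℝ) (u : E n → ℝ) (x : E n) :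
    fderiv ℝ u x (vgrad ε u x) = vgradSq ε u x := by
  rw [← inner_gradient_left, vgrad, vgradSq, inner_add_right, real_inner_smul_right,
    real_inner_smul_right, ← euler_eq, real_inner_self_eq_norm_sq]
  ring

theorem gradSq_eq (ε : ℝ) (u : E n → ℝ) {x : E n} (hx : x ≠ 0) :
    gradSq ε u x = vgradSq ε u x := by
  rw [gradSq, metric_grad ε u hx, grad_eq ε u hx, fderiv_vgrad]

theorem inner_angle_vgrad (ε : ℝ) (u : E n → ℝ) {x : E n} (hx : x ≠ 0) :
    inner ℝ (angle x) (vgrad ε u x) = euler u x * ‖x‖⁻¹ := by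
  have h0 : 0 < ‖x‖ := norm_pos_iff.2 hx
  have h1 : inner ℝ (angle x) x = ‖x‖ := by
    rw [angle, real_inner_smul_left, real_inner_self_eq_norm_sq]; field_simp
  rw [vgrad, inner_add_right, real_inner_smul_right, real_inner_smul_right, inner_angle_gradient,
    h1, rpow_neg_two h0]
  field_simp
  ring

/-! ### Regularity away from the tip -/

theorem contDiffAt_norm_rpow {k : WithTop ℕ∞} (p : ℝ) {x : E n} (hx : x ≠ 0) :
    ContDiffAt ℝ k (fun y : E n => ‖y‖ ^ p) x :=
  (contDiffAt_norm ℝ hx).rpow_const_of_ne (norm_ne_zero_iff.2 hx)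

theorem hasFDerivAt_norm_rpow (p : ℝ) {x : E n} (hx : x ≠ 0) :
    HasFDerivAt (fun y : E n => ‖y‖ ^ p) ((p * ‖x‖ ^ (p - 1)) • fderiv ℝ (fun y : E n => ‖y‖) x)
      x :=
  ((contDiffAt_norm ℝ hx (n := 1)).differentiableAt (by simp)).hasFDerivAt.rpow_const
    (Or.inl (norm_ne_zero_iff.2 hx))

theorem fderiv_norm_rpow_self (p : ℝ) {x : E n} (hx : x ≠ 0) :
    ((p * ‖x‖ ^ (p - 1)) • fderiv ℝ (fun y : E n => ‖y‖) x) x = p * ‖x‖ ^ p := by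
  have h0 : 0 < ‖x‖ := norm_pos_iff.2 hx
  rw [smul_apply, fderiv_norm hx, angle, real_inner_smul_left,
    real_inner_self_eq_norm_sq, smul_eq_mul, Real.rpow_sub_one h0.ne']
  field_simp

theorem gradient_eq_sum (u : E n → ℝ) (x : E n) :
    gradient u x = ∑ i, fderiv ℝ u x (EuclideanSpace.single i 1) • EuclideanSpace.single i (1 : ℝ) := by
  ext j
  have : inner ℝ (gradient u x) (EuclideanSpace.single j (1 : ℝ)) =
      fderiv ℝ u x (EuclideanSpace.single j 1) := inner_gradient_left ..
  rw [EuclideanSpace.inner_single_right] at this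
  simp [Pi.single_apply] at this ⊢
  exact this

section

variable {u : E n → ℝ} {x : E n}

theorem contDiffAt_fderiv (hu : ContDiffAt ℝ 2 u x) : ContDiffAt ℝ 1 (fderiv ℝ u) x :=
  hu.fderiv_right (by norm_num)

theorem contDiffAt_euler (hu : ContDiffAt ℝ 2 u x) : ContDiffAt ℝ 1 (euler u) x :=
  (contDiffAt_fderiv hu).clm_apply contDiffAt_id

theorem contDiffAt_gradient (hu : ContDiffAt ℝ 2 u x) : ContDiffAt ℝ 1 (gradient u) x := by
  have : gradient u = fun x => ∑ i, fderiv ℝ u x (EuclideanSpace.single i 1) •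
      EuclideanSpace.single i (1 : ℝ) := funext (gradient_eq_sum u)
  rw [this]
  exact ContDiffAt.sum fun i _ =>
    ((contDiffAt_fderiv hu).clm_apply contDiffAt_const).smul contDiffAt_const

theorem contDiffAt_vgrad (ε : ℝ) (hx : x ≠ 0) (hu : ContDiffAt ℝ 2 u x) :
    ContDiffAt ℝ 1 (vgrad ε u) x :=
  ((contDiffAt_const.mul (contDiffAt_norm_rpow _ hx)).smul (contDiffAt_gradient hu)).add
    (((contDiffAt_const.sub (contDiffAt_const.mul (contDiffAt_norm_rpow _ hx))).mul
      ((contDiffAt_euler hu).mul (contDiffAt_norm_rpow _ hx))).smul contDiffAt_id)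

theorem contDiffAt_vgradSq (ε : ℝ) (hx : x ≠ 0) (hu : ContDiffAt ℝ 2 u x) :
    ContDiffAt ℝ 1 (vgradSq ε u) x :=
  ((contDiffAt_const.mul (contDiffAt_norm_rpow _ hx)).mul ((contDiffAt_gradient hu).norm_sq ℝ)).add
    ((contDiffAt_const.sub (contDiffAt_const.mul (contDiffAt_norm_rpow _ hx))).mul
      (((contDiffAt_euler hu).pow 2).mul (contDiffAt_norm_rpow _ hx)))

theorem hasFDerivAt_fderiv (hu : ContDiffAt ℝ 2 u x) :
    HasFDerivAt (fderiv ℝ u) (fderiv ℝ (fderiv ℝ u) x) x :=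
  ((contDiffAt_fderiv hu).differentiableAt (by simp)).hasFDerivAt

theorem fderiv_euler (hu : ContDiffAt ℝ 2 u x) (v : E n) :
    fderiv ℝ (euler u) x v = fderiv ℝ (fderiv ℝ u) x v x + fderiv ℝ u x v := by
  have h : fderiv ℝ (euler u) x = _ :=
    ((hasFDerivAt_fderiv hu).clm_apply (hasFDerivAt_id x)).fderiv
  rw [h]
  simp [add_comm]

theorem fderiv_norm_sq_gradient (hu : ContDiffAt ℝ 2 u x) (v : E n) :
    fderiv ℝ (fun y => ‖gradient u y‖ ^ 2) x v =
      2 * fderiv ℝ (fderiv ℝ u) x v (gradient u x) := by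
  have hg : HasFDerivAt (gradient u) (fderiv ℝ (gradient u) x) x :=
    ((contDiffAt_gradient hu).differentiableAt (by simp)).hasFDerivAt
  have h1 : inner ℝ (fderiv ℝ (gradient u) x v) (gradient u x) =
      fderiv ℝ (fderiv ℝ u) x v (gradient u x) := by
    have e : (fun y => inner ℝ (gradient u y) (gradient u x)) =
        fun y => fderiv ℝ u y (gradient u x) := funext fun y => inner_gradient_left ..
    have h2 := (hg.inner ℝ (hasFDerivAt_const (gradient u x) x))
    rw [e] at h2
    have h3 := ((hasFDerivAt_fderiv hu).clm_apply (hasFDerivAt_const (gradient u x) x)).unique h2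
    have h4 := congrArg (fun L => L v) h3
    simp at h4
    rw [real_inner_comm, inner_gradient_left]
    exact h4.symm
  rw [hg.norm_sq.fderiv]
  simp [← h1]

/-- The derivative of the energy density in the radial direction. -/
theorem fderiv_vgradSq (ε : ℝ) (hx : x ≠ 0) (hu : ContDiffAt ℝ 2 u x) :
    fderiv ℝ (vgradSq ε u) x x =
      4 * ‖x‖ ^ (-2 * ε) * (2 * fderiv ℝ (fderiv ℝ u) x x (gradient u x)) +
      4 * (-2 * ε * ‖x‖ ^ (-2 * ε)) * ‖gradient u x‖ ^ 2 +
      (1 - 4 * ‖x‖ ^ (-2 * ε)) * (euler u x ^ 2 * (-2 * ‖x‖ ^ (-2 : ℝ)) +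
        2 * euler u x * (fderiv ℝ (fderiv ℝ u) x x x + euler u x) * ‖x‖ ^ (-2 : ℝ)) -
      4 * (-2 * ε * ‖x‖ ^ (-2 * ε)) * (euler u x ^ 2 * ‖x‖ ^ (-2 : ℝ)) := by
  have h1 := hasFDerivAt_norm_rpow (-2 * ε) hx
  have h2 := hasFDerivAt_norm_rpow (-2 : ℝ) hx
  have h3 : HasFDerivAt (euler u) (fderiv ℝ (euler u) x) x :=
    ((contDiffAt_euler hu).differentiableAt (by simp)).hasFDerivAt
  have h4 : HasFDerivAt (fun y => ‖gradient u y‖ ^ 2) (fderiv ℝ (fun y => ‖gradient u y‖ ^ 2) x) x :=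
    (((contDiffAt_gradient hu).norm_sq ℝ).differentiableAt (by simp)).hasFDerivAt
  have e1 := fderiv_norm_rpow_self (-2 * ε) hx
  have e2 := fderiv_norm_rpow_self (-2 : ℝ) hx
  have e3 := fderiv_euler hu x
  have e4 := fderiv_norm_sq_gradient hu x
  have h : fderiv ℝ (vgradSq ε u) x = _ := (((h1.const_mul 4).mul h4).add
    (((h1.const_mul 4).const_sub 1).mul ((h3.pow 2).mul h2))).fderiv
  rw [h]
  generalize (-2 * ε * ‖x‖ ^ (-2 * ε - 1)) • fderiv ℝ (fun y : E n => ‖y‖) x = L1 at *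
  generalize (-2 * ‖x‖ ^ ((-2 : ℝ) - 1)) • fderiv ℝ (fun y : E n => ‖y‖) x = L2 at *
  generalize fderiv ℝ (euler u) x = L3 at *
  generalize fderiv ℝ (fun y => ‖gradient u y‖ ^ 2) x = L4 at *
  simp only [add_apply, smul_apply,
    neg_apply, smul_eq_mul, e1, e2, e3, e4, nsmul_eq_mul, Pi.mul_apply]
  simp only [← euler.eq_1]
  push_cast
  ring

end

/-! ### The divergence of the two vector fields -/

/-- The weighted gradient field `density • ∇u`, in explicit form. -/
noncomputable def flux (ε N η : ℝ) (u : E n → ℝ) (x : E n) : E n :=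
  (hornCoef n * ‖x‖ ^ hornExp n ε N η) • vgrad ε u x

/-- The coefficient of `x` in the Rellich-Pohozaev field. -/
noncomputable def pohozaevCoef (ε N η lam : ℝ) (u : E n → ℝ) (x : E n) : ℝ :=
  1 / 2 * (vgradSq ε u x + lam * u x ^ 2) * (hornCoef n * ‖x‖ ^ hornExp n ε N η)

/-- The vector field whose divergence gives the Rellich-Pohozaev identity. -/
noncomputable def pohozaevField (ε N η lam : ℝ) (u : E n → ℝ) (x : E n) : E n :=
  euler u x • flux ε N η u x - pohozaevCoef ε N η lam u x • x

section

variable {ε N η lam : ℝ} {u : E n → ℝ} {x : E n}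

theorem contDiffAt_flux (hx : x ≠ 0) (hu : ContDiffAt ℝ 2 u x) :
    ContDiffAt ℝ 1 (flux ε N η u) x :=
  (contDiffAt_const.mul (contDiffAt_norm_rpow _ hx)).smul (contDiffAt_vgrad ε hx hu)

theorem contDiffAt_pohozaevCoef (hx : x ≠ 0) (hu : ContDiffAt ℝ 2 u x) :
    ContDiffAt ℝ 1 (pohozaevCoef ε N η lam u) x :=
  (contDiffAt_const.mul ((contDiffAt_vgradSq ε hx hu).add (contDiffAt_const.mul
    ((hu.of_le (by norm_num)).pow 2)))).mul (contDiffAt_const.mul (contDiffAt_norm_rpow _ hx))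

theorem contDiffAt_pohozaevField (hx : x ≠ 0) (hu : ContDiffAt ℝ 2 u x) :
    ContDiffAt ℝ 1 (pohozaevField ε N η lam u) x :=
  ((contDiffAt_euler hu).smul (contDiffAt_flux hx hu)).sub
    ((contDiffAt_pohozaevCoef hx hu).smul contDiffAt_id)

theorem div_flux (hn : 1 ≤ n) (hx : x ≠ 0) (h : laplacian ε N η u x = lam * u x) :
    div (flux ε N η u) x = hornCoef n * ‖x‖ ^ hornExp n ε N η * (lam * u x) := by
  have h0 : 0 < ‖x‖ := norm_pos_iff.2 hx
  have hd : 0 < hornCoef n * ‖x‖ ^ hornExp n ε N η :=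
    mul_pos hornCoef_pos (Real.rpow_pos_of_pos h0 _)
  have hev : (fun y => density n ε N η y • grad ε u y) =ᶠ[𝓝 x] flux ε N η u := by
    filter_upwards [isOpen_ne.mem_nhds hx] with y hy
    rw [flux, density_eq hn ε N η hy, grad_eq ε u hy]
  have hdiv : div (fun y => density n ε N η y • grad ε u y) x = div (flux ε N η u) x := by
    simp only [div, hev.fderiv_eq]
  rw [laplacian, hdiv, density_eq hn ε N η hx, inv_mul_eq_div, div_eq_iff hd.ne'] at h
  rw [h]; ring

theorem div_smul_flux (hn : 1 ≤ n) (hx : x ≠ 0) (hu : ContDiffAt ℝ 2 u x)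
    (h : laplacian ε N η u x = lam * u x) :
    div (fun y => u y • flux ε N η u y) x =
      hornCoef n * ‖x‖ ^ hornExp n ε N η * (vgradSq ε u x + lam * u x ^ 2) := by
  rw [div_smul (hu.differentiableAt (by simp))
    ((contDiffAt_flux hx hu).differentiableAt (by simp)), div_flux hn hx h, flux, map_smul,
    fderiv_vgrad, smul_eq_mul]
  ring

theorem div_sub {X Y : E n → E n} (hX : DifferentiableAt ℝ X x) (hY : DifferentiableAt ℝ Y x) :
    div (fun y => X y - Y y) x = div X x - div Y x := by
  simp [div, fderiv_fun_sub hX hY, Finset.sum_sub_distrib]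

theorem div_id : div (fun y : E n => y) x = n := by
  simp [div]

/-- The second derivatives of `u` cancel, by the symmetry of the Hessian. -/
theorem div_pohozaevField (hn : 1 ≤ n) (hx : x ≠ 0) (hu : ContDiffAt ℝ 2 u x)
    (h : laplacian ε N η u x = lam * u x) :
    div (pohozaevField ε N η lam u) x = 1 / 2 * (hornCoef n * ‖x‖ ^ hornExp n ε N η *
      ((1 - (hornExp n ε N η + (n - 1))) * (euler u x ^ 2 * ‖x‖ ^ (-2 : ℝ)) +
        (1 + 2 * ε - (hornExp n ε N η + (n - 1))) *
          (vgradSq ε u x - euler u x ^ 2 * ‖x‖ ^ (-2 : ℝ)) -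
        (hornExp n ε N η + (n - 1) + 1) * lam * u x ^ 2)) := by
  have dE := (contDiffAt_euler hu).differentiableAt one_ne_zero
  have dF := (contDiffAt_flux (ε := ε) (N := N) (η := η) hx hu).differentiableAt one_ne_zero
  have dC := (contDiffAt_pohozaevCoef (ε := ε) (N := N) (η := η) (lam := lam) hx
    hu).differentiableAt one_ne_zero
  have du := hu.differentiableAt two_ne_zero
  have dG := (contDiffAt_vgradSq ε hx hu).differentiableAt one_ne_zero
  have hsub : div (pohozaevField ε N η lam u) x = _ :=
    div_sub (dE.smul dF) (dC.smul differentiableAt_id)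
  have hE : div (euler u • flux ε N η u) x = _ := div_smul dE dF
  have hCid : div (pohozaevCoef ε N η lam u • id) x = _ :=
    div_smul (X := fun y => y) dC differentiableAt_id
  change div (pohozaevField ε N η lam u) x = div (euler u • flux ε N η u) x -
    div (pohozaevCoef ε N η lam u • id) x at hsub
  rw [hsub, hE, hCid, div_flux hn hx h, div_id, fderiv_euler hu]
  have hC : fderiv ℝ (pohozaevCoef ε N η lam u) x x =
      1 / 2 * (fderiv ℝ (vgradSq ε u) x x + lam * (2 * u x * euler u x)) *
        (hornCoef n * ‖x‖ ^ hornExp n ε N η) +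
      1 / 2 * (vgradSq ε u x + lam * u x ^ 2) *
        (hornCoef n * (hornExp n ε N η * ‖x‖ ^ hornExp n ε N η)) := by
    have e1 := fderiv_norm_rpow_self (hornExp n ε N η) hx
    have h' : fderiv ℝ (pohozaevCoef ε N η lam u) x = _ :=
      ((((dG.hasFDerivAt.add ((du.hasFDerivAt.pow 2).const_mul lam)).const_mul (1 / 2)).mul
        ((hasFDerivAt_norm_rpow (hornExp n ε N η) hx).const_mul (hornCoef n)))).fderiv
    rw [h']
    simp only [add_apply, smul_apply, smul_eq_mul, nsmul_eq_mul, Pi.add_apply]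
    rw [smul_apply, smul_eq_mul] at e1
    rw [e1, euler]
    push_cast
    ring
  have hsymm : fderiv ℝ (fderiv ℝ u) x (gradient u x) x =
      fderiv ℝ (fderiv ℝ u) x x (gradient u x) :=
    (hu.isSymmSndFDerivAt (by simp)).eq _ _
  rw [hC, fderiv_vgradSq ε hx hu, flux, map_smul, map_smul, fderiv_vgrad, pohozaevCoef]
  have hD : fderiv ℝ (fderiv ℝ u) x (vgrad ε u x) x =
      4 * ‖x‖ ^ (-2 * ε) * fderiv ℝ (fderiv ℝ u) x x (gradient u x) +
        (1 - 4 * ‖x‖ ^ (-2 * ε)) * (euler u x * ‖x‖ ^ (-2 : ℝ)) *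
          fderiv ℝ (fderiv ℝ u) x x x := by
    rw [vgrad, map_add, map_smul, map_smul, add_apply, smul_apply, smul_apply, hsymm]
    simp only [smul_eq_mul]
  rw [smul_apply, hD, smul_eq_mul, smul_eq_mul, vgradSq]
  ring

theorem inner_angle_flux (hx : x ≠ 0) :
    inner ℝ (angle x) (flux ε N η u x) =
      hornCoef n * ‖x‖ ^ hornExp n ε N η * (euler u x * ‖x‖⁻¹) := by
  rw [flux, real_inner_smul_right, inner_angle_vgrad ε u hx]

theorem inner_angle_pohozaevField (hx : x ≠ 0) :
    inner ℝ (angle x) (pohozaevField ε N η lam u x) =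
      1 / 2 * (hornCoef n * ‖x‖ ^ hornExp n ε N η * ‖x‖ *
        (euler u x ^ 2 * ‖x‖ ^ (-2 : ℝ) - (vgradSq ε u x - euler u x ^ 2 * ‖x‖ ^ (-2 : ℝ)) -
          lam * u x ^ 2)) := by
  have h0 : 0 < ‖x‖ := norm_pos_iff.2 hx
  have h1 : inner ℝ (angle x) x = ‖x‖ := by
    rw [angle, real_inner_smul_left, real_inner_self_eq_norm_sq]; field_simp
  rw [pohozaevField, inner_sub_right, real_inner_smul_right, real_inner_smul_right,
    inner_angle_flux hx, h1, pohozaevCoef, rpow_neg_two h0]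
  field_simp
  ring

end

/-! ### The radial system of an eigenfunction on the horn -/

/-- `J(r) = ∫ u² dω`. -/
noncomputable def sphJ (u : E n → ℝ) : ℝ → ℝ := sphInt fun x => u x ^ 2

/-- `G(r) = ∫ u uᵣ dω`. -/
noncomputable def sphG (u : E n → ℝ) : ℝ → ℝ := sphInt fun x => u x * (euler u x * ‖x‖⁻¹)

/-- `P(r) = ∫ uᵣ² dω`. -/
noncomputable def sphP (u : E n → ℝ) : ℝ → ℝ := sphInt fun x => euler u x ^ 2 * ‖x‖ ^ (-2 : ℝ)

/-- `Q(r) = ∫ (|∇u|² - uᵣ²) dω`, the contribution of the angular derivatives. -/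
noncomputable def sphQ (ε : ℝ) (u : E n → ℝ) : ℝ → ℝ :=
  sphInt fun x => vgradSq ε u x - euler u x ^ 2 * ‖x‖ ^ (-2 : ℝ)

theorem sphInt_radial_mul (φ : ℝ → ℝ) (F : E n → ℝ) {r : ℝ} (hr : 0 < r) :
    sphInt (fun x => φ ‖x‖ * F x) r = φ r * sphInt F r := by
  unfold sphInt
  rw [← integral_const_mul]
  exact integral_congr_ae (ae_of_all _ fun ω => by simp only [norm_smul_sphere hr])

theorem sphInt_comb {F₁ F₂ F₃ : E n → ℝ} {R r : ℝ} (h₁ : ContinuousOn F₁ (ball 0 R \ {0}))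
    (h₂ : ContinuousOn F₂ (ball 0 R \ {0})) (h₃ : ContinuousOn F₃ (ball 0 R \ {0}))
    (hr : r ∈ Ioo 0 R) (a b c : ℝ) :
    sphInt (fun x => a * F₁ x + b * F₂ x + c * F₃ x) r =
      a * sphInt F₁ r + b * sphInt F₂ r + c * sphInt F₃ r := by
  have i₁ := (integrable_sphere_slice h₁ hr).const_mul a
  have i₂ := (integrable_sphere_slice h₂ hr).const_mul b
  have i₃ := (integrable_sphere_slice h₃ hr).const_mul c
  have e := integral_add (i₁.add i₂) i₃
  simp only [Pi.add_apply] at e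
  unfold sphInt
  rw [e, integral_add i₁ i₂, integral_const_mul, integral_const_mul, integral_const_mul]

/-- Cauchy-Schwarz inequality on a sphere. -/
theorem sphInt_mul_sq_le {f g : E n → ℝ} {R r : ℝ} (hf : ContinuousOn f (ball 0 R \ {0}))
    (hg : ContinuousOn g (ball 0 R \ {0})) (hr : r ∈ Ioo 0 R) :
    sphInt (fun x => f x * g x) r ^ 2 ≤
      sphInt (fun x => g x ^ 2) r * sphInt (fun x => f x ^ 2) r := by
  have h : ∀ t : ℝ, 0 ≤ sphInt (fun x => g x ^ 2) r * (t * t) +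
      2 * sphInt (fun x => f x * g x) r * t + sphInt (fun x => f x ^ 2) r := by
    intro t
    have e := sphInt_comb (hg.pow 2) (hf.mul hg) (hf.pow 2) hr (t * t) (2 * t) 1
    have hnn : 0 ≤ sphInt (fun x => t * t * g x ^ 2 + 2 * t * (f x * g x) + 1 * f x ^ 2) r :=
      integral_nonneg fun ω => by
        simp only [Pi.zero_apply]
        nlinarith [sq_nonneg (t * g (r • (ω : E n)) + f (r • (ω : E n)))]
    have e' : sphInt (fun x => t * t * g x ^ 2 + 2 * t * (f x * g x) + 1 * f x ^ 2) r = _ := e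
    rw [e'] at hnn
    simp only [Pi.pow_def, Pi.mul_def] at hnn
    linarith
  have := discrim_le_zero h
  rw [discrim] at this
  nlinarith

section

variable {ε N η lam R : ℝ} {u : E n → ℝ}

theorem IsEigenfunction.contDiffAt (h : IsEigenfunction ε N η lam R u) {x : E n}
    (hx : x ∈ ball (0 : E n) R \ {0}) : ContDiffAt ℝ 2 u x :=
  h.contDiffOn.contDiffAt (isOpen_punctured.mem_nhds hx)

theorem IsEigenfunction.cont_u (h : IsEigenfunction ε N η lam R u) :
    ContinuousOn u (ball 0 R \ {0}) := h.contDiffOn.continuousOn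

theorem IsEigenfunction.cont_euler (h : IsEigenfunction ε N η lam R u) :
    ContinuousOn (euler u) (ball 0 R \ {0}) := fun _ hx =>
  (contDiffAt_euler (h.contDiffAt hx)).continuousAt.continuousWithinAt

theorem IsEigenfunction.cont_vgradSq (h : IsEigenfunction ε N η lam R u) :
    ContinuousOn (vgradSq ε u) (ball 0 R \ {0}) := fun _ hx =>
  (contDiffAt_vgradSq ε hx.2 (h.contDiffAt hx)).continuousAt.continuousWithinAt

theorem IsEigenfunction.cont_p (h : IsEigenfunction ε N η lam R u) :
    ContinuousOn (fun x => euler u x ^ 2 * ‖x‖ ^ (-2 : ℝ)) (ball 0 R \ {0}) :=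
  (h.cont_euler.pow 2).mul fun _ hx =>
    (contDiffAt_norm_rpow (k := 0) _ hx.2).continuousAt.continuousWithinAt

theorem IsEigenfunction.cont_q (h : IsEigenfunction ε N η lam R u) :
    ContinuousOn (fun x => vgradSq ε u x - euler u x ^ 2 * ‖x‖ ^ (-2 : ℝ)) (ball 0 R \ {0}) :=
  h.cont_vgradSq.sub h.cont_p

theorem pow_mul_rpow (hn : 1 ≤ n) (β : ℝ) {t : ℝ} (ht : 0 < t) :
    t ^ (n - 1) * t ^ β = t ^ (β + ((n : ℝ) - 1)) := by
  rw [Real.rpow_add ht, mul_comm]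
  congr 1
  rw [← Real.rpow_natCast]; push_cast [Nat.cast_sub hn]; rfl

/-- The radial part of the gradient is at most the gradient. -/
theorem angular_nonneg (ε : ℝ) (u : E n → ℝ) {x : E n} (hx : x ≠ 0) :
    0 ≤ vgradSq ε u x - euler u x ^ 2 * ‖x‖ ^ (-2 : ℝ) := by
  have h0 : 0 < ‖x‖ := norm_pos_iff.2 hx
  have h1 : euler u x ^ 2 * ‖x‖ ^ (-2 : ℝ) ≤ ‖gradient u x‖ ^ 2 := by
    rw [rpow_neg_two h0, inv_pow, ← div_eq_mul_inv, div_le_iff₀ (by positivity), ← mul_pow, euler_eq]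
    apply sq_le_sq'
    · linarith [neg_abs_le (inner ℝ (gradient u x) x), abs_real_inner_le_norm (gradient u x) x]
    · exact real_inner_le_norm _ _
  have h2 := Real.rpow_nonneg h0.le (-2 * ε)
  unfold vgradSq
  nlinarith [mul_nonneg h2 (sub_nonneg.2 h1)]

theorem hasDerivAt_sphG (hn : 1 ≤ n) (h : IsEigenfunction ε N η lam R u) {r : ℝ}
    (hr : r ∈ Ioo 0 R) :
    HasDerivAt (fun t => t ^ (hornExp n ε N η + (n - 1)) * sphG u t)
      (r ^ (hornExp n ε N η + (n - 1)) * (sphP u r + sphQ ε u r + lam * sphJ u r)) r := by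
  have hX : ContDiffOn ℝ 1 (fun y => u y • flux ε N η u y) (ball 0 R \ {0}) := fun x hx =>
    (((h.contDiffAt hx).of_le (by norm_num)).smul
      (contDiffAt_flux hx.2 (h.contDiffAt hx))).contDiffWithinAt
  have hK := hornCoef_pos (n := n)
  have hd := (hasDerivAt_flux hn hX hr).const_mul (hornCoef n)⁻¹
  set β := hornExp n ε N η with hβ
  have e1 : ∀ t ∈ Ioo 0 R, (hornCoef n)⁻¹ * (t ^ (n - 1) * sphInt (fun x =>
      inner ℝ (angle x) (u x • flux ε N η u x)) t) = t ^ (β + (n - 1)) * sphG u t := by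
    intro t ht
    rw [sphInt_congr (H := fun x => (hornCoef n * ‖x‖ ^ β) * (u x * (euler u x * ‖x‖⁻¹)))
      (fun x hx => ?_) ht.1, sphInt_radial_mul (fun s => hornCoef n * s ^ β) _ ht.1, ← sphG,
      ← pow_mul_rpow hn β ht.1]
    · field_simp
    · have hx0 : x ≠ 0 := norm_pos_iff.1 (hx ▸ ht.1)
      rw [real_inner_smul_right, inner_angle_flux hx0]; ring
  have e2 : (hornCoef n)⁻¹ * (r ^ (n - 1) * sphInt (div fun y => u y • flux ε N η u y) r) =
      r ^ (β + (n - 1)) * (sphP u r + sphQ ε u r + lam * sphJ u r) := by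
    have hc := sphInt_comb h.cont_p h.cont_q (h.cont_u.pow 2) hr 1 1 lam
    rw [one_mul, one_mul] at hc
    rw [sphP, sphQ, sphJ]
    refine Eq.trans ?_ (congrArg _ hc)
    rw [sphInt_congr (H := fun x => (hornCoef n * ‖x‖ ^ β) *
      (1 * (euler u x ^ 2 * ‖x‖ ^ (-2 : ℝ)) + 1 * (vgradSq ε u x - euler u x ^ 2 * ‖x‖ ^ (-2 : ℝ)) +
        lam * (u x ^ 2)))
      (fun x hx => ?_) hr.1, sphInt_radial_mul (fun s => hornCoef n * s ^ β) _ hr.1,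
      ← pow_mul_rpow hn β hr.1]
    · field_simp
      rfl
    · have hx0 : x ≠ 0 := norm_pos_iff.1 (hx ▸ hr.1)
      have hxΩ : x ∈ ball (0 : E n) R \ {0} := ⟨mem_ball_zero_iff.2 (hx ▸ hr.2), hx0⟩
      rw [div_smul_flux hn hx0 (h.contDiffAt hxΩ) (h.eq x hxΩ)]
      ring
  rw [e2] at hd
  refine hd.congr_of_eventuallyEq ?_
  filter_upwards [isOpen_Ioo.mem_nhds hr] with t ht using (e1 t ht).symm

theorem hasDerivAt_pohozaev (hn : 1 ≤ n) (h : IsEigenfunction ε N η lam R u) {r : ℝ}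
    (hr : r ∈ Ioo 0 R) :
    HasDerivAt (fun t => t ^ (hornExp n ε N η + (n - 1) + 1) *
        (sphP u t - sphQ ε u t - lam * sphJ u t))
      (r ^ (hornExp n ε N η + (n - 1)) * ((1 - (hornExp n ε N η + (n - 1))) * sphP u r +
        (1 + 2 * ε - (hornExp n ε N η + (n - 1))) * sphQ ε u r -
        (hornExp n ε N η + (n - 1) + 1) * lam * sphJ u r)) r := by
  have hX : ContDiffOn ℝ 1 (pohozaevField ε N η lam u) (ball 0 R \ {0}) := fun x hx =>
    (contDiffAt_pohozaevField hx.2 (h.contDiffAt hx)).contDiffWithinAt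
  have hK := hornCoef_pos (n := n)
  have hd := (hasDerivAt_flux hn hX hr).const_mul (2 * (hornCoef n)⁻¹)
  set β := hornExp n ε N η with hβ
  have hcomb : ∀ t ∈ Ioo 0 R, ∀ a b c : ℝ, sphInt (fun x =>
      a * (euler u x ^ 2 * ‖x‖ ^ (-2 : ℝ)) +
        b * (vgradSq ε u x - euler u x ^ 2 * ‖x‖ ^ (-2 : ℝ)) + c * (u x ^ 2)) t =
        a * sphP u t + b * sphQ ε u t + c * sphJ u t := fun t ht a b c =>
    sphInt_comb h.cont_p h.cont_q (h.cont_u.pow 2) ht a b c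
  have e1 : ∀ t ∈ Ioo 0 R, 2 * (hornCoef n)⁻¹ * (t ^ (n - 1) * sphInt (fun x =>
      inner ℝ (angle x) (pohozaevField ε N η lam u x)) t) =
      t ^ (β + (n - 1) + 1) * (sphP u t - sphQ ε u t - lam * sphJ u t) := by
    intro t ht
    rw [sphInt_congr (H := fun x => (1 / 2 * (hornCoef n * ‖x‖ ^ β * ‖x‖)) *
      (1 * (euler u x ^ 2 * ‖x‖ ^ (-2 : ℝ)) +
        (-1) * (vgradSq ε u x - euler u x ^ 2 * ‖x‖ ^ (-2 : ℝ)) + (-lam) * (u x ^ 2)))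
      (fun x hx => ?_) ht.1, sphInt_radial_mul (fun s => 1 / 2 * (hornCoef n * s ^ β * s)) _ ht.1,
      hcomb t ht, Real.rpow_add_one ht.1.ne', ← pow_mul_rpow hn β ht.1]
    · field_simp
      ring
    · have hx0 : x ≠ 0 := norm_pos_iff.1 (hx ▸ ht.1)
      rw [inner_angle_pohozaevField hx0]; ring
  have e2 : 2 * (hornCoef n)⁻¹ * (r ^ (n - 1) * sphInt (div (pohozaevField ε N η lam u)) r) =
      r ^ (β + (n - 1)) * ((1 - (β + (n - 1))) * sphP u r +
        (1 + 2 * ε - (β + (n - 1))) * sphQ ε u r - (β + (n - 1) + 1) * lam * sphJ u r) := by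
    rw [sphInt_congr (H := fun x => (1 / 2 * (hornCoef n * ‖x‖ ^ β)) *
      ((1 - (β + (n - 1))) * (euler u x ^ 2 * ‖x‖ ^ (-2 : ℝ)) +
        (1 + 2 * ε - (β + (n - 1))) * (vgradSq ε u x - euler u x ^ 2 * ‖x‖ ^ (-2 : ℝ)) +
        (-((β + (n - 1) + 1) * lam)) * (u x ^ 2)))
      (fun x hx => ?_) hr.1, sphInt_radial_mul (fun s => 1 / 2 * (hornCoef n * s ^ β)) _ hr.1,
      hcomb r hr, ← pow_mul_rpow hn β hr.1]
    · field_simp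
      ring
    · have hx0 : x ≠ 0 := norm_pos_iff.1 (hx ▸ hr.1)
      have hxΩ : x ∈ ball (0 : E n) R \ {0} := ⟨mem_ball_zero_iff.2 (hx ▸ hr.2), hx0⟩
      rw [div_pohozaevField hn hx0 (h.contDiffAt hxΩ) (h.eq x hxΩ)]
      ring
  rw [e2] at hd
  refine hd.congr_of_eventuallyEq ?_
  filter_upwards [isOpen_Ioo.mem_nhds hr] with t ht using (e1 t ht).symm

theorem hasDerivAt_sphJ (h : IsEigenfunction ε N η lam R u) {r : ℝ} (hr : r ∈ Ioo 0 R) :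
    HasDerivAt (sphJ u) (2 * sphG u r) r := by
  have h1 : ContDiffOn ℝ 1 (fun x => u x ^ 2) (ball 0 R \ {0}) :=
    (h.contDiffOn.of_le (by norm_num)).pow 2
  have hJ := hasDerivAt_sphInt h1 hr
  suffices e : 2 * sphG u r = sphInt (fun x => fderiv ℝ (fun x => u x ^ 2) x (angle x)) r by
    rw [e]; exact hJ
  refine (sphInt_radial_mul (fun _ => 2) _ hr.1).symm.trans ?_
  refine sphInt_congr (fun x hx => ?_) hr.1
  have hx0 : x ≠ 0 := norm_pos_iff.1 (hx ▸ hr.1)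
  have hxΩ : x ∈ ball (0 : E n) R \ {0} := ⟨mem_ball_zero_iff.2 (hx ▸ hr.2), hx0⟩
  have hd := ((h.contDiffAt hxΩ).differentiableAt two_ne_zero).hasFDerivAt.pow 2
  rw [hd.fderiv, angle, euler]
  simp
  ring

/-! ### Integrals with respect to the weighted volume -/

theorem hornMeasure_eq (hn : 1 ≤ n) (ε N η : ℝ) : hornMeasure n ε N η =
    (volume : Measure (E n)).withDensity fun x =>
      ((hornCoef n * ‖x‖ ^ hornExp n ε N η).toNNReal : ENNReal) := by
  have := nontrivial_E hn
  refine withDensity_congr_ae ?_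
  have h0 : ∀ᵐ x : E n, x ≠ 0 := by
    have : (volume : Measure (E n)) {0} = 0 := measure_singleton 0
    exact compl_mem_ae_iff.2 this
  filter_upwards [h0] with x hx
  rw [density_eq hn ε N η hx]; rfl

theorem integral_ball_horn (hn : 1 ≤ n) (ε N η : ℝ) {F : E n → ℝ} {r : ℝ} (hr : 0 < r)
    (hF : IntegrableOn F (ball 0 r) (hornMeasure n ε N η)) :
    IntervalIntegrable (fun t => t ^ (hornExp n ε N η + (n - 1)) * sphInt F t) volume 0 r ∧
      ∫ x in ball 0 r, F x ∂(hornMeasure n ε N η) =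
        hornCoef n * ∫ t in (0 : ℝ)..r, t ^ (hornExp n ε N η + (n - 1)) * sphInt F t := by
  set β := hornExp n ε N η with hβ
  have hK := hornCoef_pos (n := n)
  have hm : Measurable fun x : E n => (hornCoef n * ‖x‖ ^ β).toNNReal := by fun_prop
  rw [hornMeasure_eq hn, IntegrableOn, restrict_withDensity measurableSet_ball] at hF
  rw [integrable_withDensity_iff_integrable_smul hm] at hF
  have hF' : IntegrableOn (fun x => hornCoef n * ‖x‖ ^ β * F x) (ball 0 r) := by
    refine hF.congr (ae_of_all _ fun x => ?_)
    simp only [NNReal.smul_def, smul_eq_mul]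
    rw [Real.coe_toNNReal _ (by positivity)]
  obtain ⟨h1, h2⟩ := integral_ball_polar hn hr hF'
  have e : ∀ t, 0 < t → t ^ (n - 1) * sphInt (fun x => hornCoef n * ‖x‖ ^ β * F x) t =
      hornCoef n * (t ^ (β + (n - 1)) * sphInt F t) := fun t ht => by
    rw [sphInt_radial_mul (fun s => hornCoef n * s ^ β) _ ht, ← pow_mul_rpow hn β ht]; ring
  constructor
  · refine (h1.const_mul (hornCoef n)⁻¹).congr fun t ht => ?_
    rw [uIoc_of_le hr.le] at ht
    rw [e t ht.1]
    field_simp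
  · rw [hornMeasure_eq hn, restrict_withDensity measurableSet_ball,
      integral_withDensity_eq_integral_smul hm, ← intervalIntegral.integral_const_mul]
    refine Eq.trans ?_ (h2.trans ?_)
    · refine integral_congr_ae (ae_of_all _ fun x => ?_)
      simp only [NNReal.smul_def, smul_eq_mul]
      rw [Real.coe_toNNReal _ (by positivity)]
    · rw [intervalIntegral.integral_of_le hr.le, intervalIntegral.integral_of_le hr.le]
      exact setIntegral_congr_fun measurableSet_Ioc fun t ht => e t ht.1

theorem sphInt_energy (h : IsEigenfunction ε N η lam R u) (c : ℝ) {t : ℝ} (ht : t ∈ Ioo 0 R) :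
    sphInt (fun x => gradSq ε u x + c * u x ^ 2) t = sphP u t + sphQ ε u t + c * sphJ u t := by
  have hc := sphInt_comb h.cont_p h.cont_q (h.cont_u.pow 2) ht 1 1 c
  rw [one_mul, one_mul] at hc
  refine Eq.trans ?_ hc
  refine sphInt_congr (fun x hx => ?_) ht.1
  rw [gradSq_eq ε u (norm_pos_iff.1 (hx ▸ ht.1))]
  simp only [Pi.pow_apply]
  ring

theorem IsEigenfunction.radialSystem (hn : 2 ≤ n) (hε : 0 < ε) (hN : (n : ℝ) ≤ N) (hη : η ≤ 1)
    (h : IsEigenfunction ε N η lam R u) :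
    RadialSystem (hornExp n ε N η + (n - 1)) ε lam R (sphJ u) (sphG u) (sphP u) (sphQ ε u) where
  one_lt := by
    have h1 : 0 ≤ (N - n) * (1 - η) := mul_nonneg (by linarith) (by linarith)
    have h2 : (2 : ℝ) ≤ n := by exact_mod_cast hn
    have h3 : 0 < ((n : ℝ) - 1) * ε := mul_pos (by linarith) hε
    unfold hornExp
    linarith
  eps_pos := hε
  hasDerivAt_J _ hr := hasDerivAt_sphJ h hr
  hasDerivAt_G _ hr := hasDerivAt_sphG (by omega) h hr
  hasDerivAt_e _ hr := hasDerivAt_pohozaev (by omega) h hr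
  cont_P := continuousOn_sphInt h.cont_p
  cont_Q := continuousOn_sphInt h.cont_q
  nonneg_J _ _ := integral_nonneg fun _ => sq_nonneg _
  nonneg_P _ _ := integral_nonneg fun _ =>
    mul_nonneg (sq_nonneg _) (Real.rpow_nonneg (norm_nonneg _) _)
  nonneg_Q _ hr := integral_nonneg fun ω => angular_nonneg ε u (smul_sphere_mem hr ω).2
  cauchySchwarz r hr := by
    have hg : ContinuousOn (fun x => euler u x * ‖x‖⁻¹) (ball 0 R \ {0}) :=
      h.cont_euler.mul (continuous_norm.continuousOn.inv₀ fun _ hx => norm_ne_zero_iff.2 hx.2)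
    refine (sphInt_mul_sq_le h.cont_u hg hr).trans_eq ?_
    congr 1
    refine sphInt_congr (fun x hx => ?_) hr.1
    rw [rpow_neg_two (hx ▸ hr.1)]; ring
  integrable r hr := by
    refine (integral_ball_horn (by omega) ε N η hr.1 (h.energy r hr.2)).1.congr fun t ht => ?_
    rw [uIoc_of_le hr.1.le] at ht
    have := sphInt_energy h 1 ⟨ht.1, ht.2.trans_lt hr.2⟩
    rw [show (fun x => u x ^ 2 + gradSq ε u x) = fun x => gradSq ε u x + 1 * u x ^ 2 by
      funext x; ring, this]
    ring

end

open RadialSystem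

/-! ### Frequency of an eigenfunction -/

section

variable {ε N η lam R : ℝ} {u : E n → ℝ}

theorem freqI_eq (hn : 1 ≤ n) (ε N η : ℝ) (u : E n → ℝ) {r : ℝ} (hr : 0 < r) :
    freqI ε N η u r = hornCoef n * r ^ hornExp n ε N η * sphJ u r := by
  have hemb : MeasurableEmbedding fun ω : sphere (0 : E n) 1 => r • (ω : E n) :=
    (Homeomorph.smulOfNeZero r hr.ne').measurableEmbedding.comp
      (MeasurableEmbedding.subtype_coe isClosed_sphere.measurableSet)
  have hpos : 0 ≤ hornCoef n * r ^ (hornExp n ε N η + (n - 1)) :=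
    mul_nonneg hornCoef_pos.le (Real.rpow_nonneg hr.le _)
  rw [freqI, hornArea, integral_smul_measure, hemb.integral_map, weight_mul_warp hn ε N η hr,
    ENNReal.toReal_ofReal hpos, smul_eq_mul, sphJ, sphInt, Real.rpow_add hr]
  have e : r ^ (1 - (n : ℝ)) * r ^ ((n : ℝ) - 1) = 1 := by
    rw [← Real.rpow_add hr]; simp
  linear_combination (hornCoef n * r ^ hornExp n ε N η *
    ∫ ω : sphere (0 : E n) 1, u (r • (ω : E n)) ^ 2 ∂(volume : Measure (E n)).toSphere) * e

theorem freqE_eq (hn : 2 ≤ n) (hε : 0 < ε) (hN : (n : ℝ) ≤ N) (hη : η ≤ 1)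
    (h : IsEigenfunction ε N η lam R u) {r : ℝ} (hr : r ∈ Ioo 0 R) :
    freqE ε N η lam u r = hornCoef n * r ^ hornExp n ε N η * (r * sphG u r) := by
  have hn1 : 1 ≤ n := by omega
  have S := h.radialSystem hn hε hN hη
  have hae : ∀ᵐ x ∂(hornMeasure n ε N η).restrict (ball 0 r), x ∈ ball (0 : E n) R \ {0} := by
    have := nontrivial_E hn1
    have h0 : ∀ᵐ x ∂(hornMeasure n ε N η), x ≠ 0 := by
      have h1 : (volume : Measure (E n)) {0} = 0 := measure_singleton 0
      exact (withDensity_absolutelyContinuous _ _).ae_le (compl_mem_ae_iff.2 h1)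
    filter_upwards [ae_restrict_of_ae h0, ae_restrict_mem measurableSet_ball] with x hx hx'
    exact ⟨ball_subset_ball hr.2.le hx', hx⟩
  have hint : IntegrableOn (fun x => gradSq ε u x + lam * u x ^ 2) (ball 0 r)
      (hornMeasure n ε N η) := by
    -- the integrand is at most `1 + |lam|` times the energy density
    refine ((h.energy r hr.2).const_mul (1 + |lam|)).mono' ?_ ?_
    · have hc : ContinuousOn (fun x => vgradSq ε u x + lam * u x ^ 2) (ball 0 R \ {0}) :=
        h.cont_vgradSq.add (continuousOn_const.mul (h.cont_u.pow 2))
      have hm : AEStronglyMeasurable (fun x => vgradSq ε u x + lam * u x ^ 2)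
          ((hornMeasure n ε N η).restrict (ball 0 R \ {0})) :=
        hc.aestronglyMeasurable isOpen_punctured.measurableSet
      have hm' := hm.mono_measure (Measure.restrict_mono_ae
        (μ := (hornMeasure n ε N η)) (s := ball 0 r) (t := ball 0 R \ {0})
        ((ae_restrict_iff' measurableSet_ball).1 hae))
      refine hm'.congr ?_
      filter_upwards [hae] with x hx
      rw [gradSq_eq ε u hx.2]
    · filter_upwards [hae] with x hx
      have h1 : 0 ≤ gradSq ε u x := by
        rw [gradSq_eq ε u hx.2]
        have := angular_nonneg ε u hx.2
        have h2 : 0 ≤ euler u x ^ 2 * ‖x‖ ^ (-2 : ℝ) := by positivity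
        linarith
      rw [Real.norm_eq_abs]
      calc |gradSq ε u x + lam * u x ^ 2| ≤ |gradSq ε u x| + |lam * u x ^ 2| := abs_add_le _ _
        _ = gradSq ε u x + |lam| * u x ^ 2 := by
            rw [abs_of_nonneg h1, abs_mul, abs_of_nonneg (sq_nonneg (u x))]
        _ ≤ _ := by nlinarith [sq_nonneg (u x), abs_nonneg lam, mul_nonneg (abs_nonneg lam) h1]
  rw [freqE, (integral_ball_horn hn1 ε N η hr.1 hint).2]
  have hcongr : ∫ t in (0 : ℝ)..r, t ^ (hornExp n ε N η + (n - 1)) *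
      sphInt (fun x => gradSq ε u x + lam * u x ^ 2) t =
      r ^ (hornExp n ε N η + (n - 1)) * sphG u r := by
    obtain ⟨-, he⟩ := S.integral_comb hr 1 1 lam
    rw [S.green hr, ← one_mul (ballInt _ (sphP u) r), ← one_mul (ballInt _ (sphQ ε u) r), ← he,
      intervalIntegral.integral_of_le hr.1.le, intervalIntegral.integral_of_le hr.1.le]
    refine setIntegral_congr_fun measurableSet_Ioc fun t ht => ?_
    rw [sphInt_energy h lam ⟨ht.1, ht.2.trans_lt hr.2⟩, one_mul, one_mul]
  rw [hcongr, Real.rpow_add hr.1]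
  have e : r ^ (2 - (n : ℝ)) * r ^ ((n : ℝ) - 1) = r := by
    rw [← Real.rpow_add hr.1]; ring_nf; simp
  linear_combination (hornCoef n * r ^ hornExp n ε N η * sphG u r) * e

theorem normFreq_eq_mul_freqU (hn : 2 ≤ n) (hε : 0 < ε) (hN : (n : ℝ) ≤ N) (hη : η ≤ 1)
    (h : IsEigenfunction ε N η lam R u) {r : ℝ} (hr : r ∈ Ioo 0 R) :
    normFreq ε (sphJ u) (sphG u) r = r ^ (2 * ε) * freqU ε N η lam u r := by
  have hd : hornCoef n * r ^ hornExp n ε N η ≠ 0 :=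
    (mul_pos hornCoef_pos (Real.rpow_pos_of_pos hr.1 _)).ne'
  rw [freqU, freqE_eq hn hε hN hη h hr, freqI_eq (by omega) ε N η u hr.1, mul_div_mul_left _ _ hd,
    normFreq, Real.rpow_add_one hr.1.ne']
  ring

theorem eq_zero_of_sphJ_eq_zero (h : IsEigenfunction ε N η lam R u) {x : E n}
    (hx : x ∈ ball (0 : E n) R \ {0}) (hJ : sphJ u ‖x‖ = 0) : u x = 0 := by
  have h0 : 0 < ‖x‖ := norm_pos_iff.2 hx.2
  have hr : ‖x‖ ∈ Ioo 0 R := ⟨h0, mem_ball_zero_iff.1 hx.1⟩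
  have hc := continuous_sphere_slice (h.cont_u.pow 2) hr
  by_contra hne
  have hpos := hc.integral_pos_of_hasCompactSupport_nonneg_nonzero
    (μ := (volume : Measure (E n)).toSphere) (x := ⟨angle x, by
      rw [mem_sphere_zero_iff_norm, angle, norm_smul, norm_inv, norm_norm,
        inv_mul_cancel₀ h0.ne']⟩)
    (HasCompactSupport.of_compactSpace _) (fun ω => sq_nonneg _) (by
      have : ‖x‖ • angle x = x := by rw [angle, smul_smul, mul_inv_cancel₀ h0.ne', one_smul]
      simpa [this] using hne)
  exact hpos.ne' hJ

theorem sphJ_ne_zero (h : IsEigenfunction ε N η lam R u)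
    (hne : ∃ x ∈ ball (0 : E n) R \ {0}, u x ≠ 0) : ∃ t ∈ Ioo 0 R, sphJ u t ≠ 0 := by
  obtain ⟨x, hx, hux⟩ := hne
  exact ⟨‖x‖, ⟨norm_pos_iff.2 hx.2, mem_ball_zero_iff.1 hx.1⟩,
    fun hJ => hux (eq_zero_of_sphJ_eq_zero h hx hJ)⟩

/-- The power weight is absorbed by the exponential. -/
theorem exp_le_rpow {β ε r : ℝ} (hβ : 0 ≤ β) (hε : 0 < ε) (hr : 0 < r) :
    Real.exp (-(β / (2 * ε) * r ^ (-2 * ε))) ≤ r ^ β := by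
  rw [Real.rpow_def_of_pos hr β, Real.exp_le_exp]
  have h1 := Real.log_le_sub_one_of_pos (Real.rpow_pos_of_pos hr (-2 * ε))
  rw [Real.log_rpow hr] at h1
  have h2 : -(r ^ (-2 * ε)) ≤ 2 * ε * Real.log r := by linarith
  have h3 : β / (2 * ε) * (-(r ^ (-2 * ε))) ≤ β / (2 * ε) * (2 * ε * Real.log r) := by gcongr
  have h4 : β / (2 * ε) * (2 * ε * Real.log r) = Real.log r * β := by field_simp
  linarith

theorem exists_radius (hε : 0 < ε) (lam : ℝ) :
    ∃ r₀ : ℝ, 0 < r₀ ∧ r₀ ≤ 1 ∧ (0 ≤ lam → r₀ = 1) ∧ IsSmall ε lam r₀ := by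
  by_cases hl : 0 ≤ lam
  · refine ⟨1, one_pos, le_rfl, fun _ => rfl, ?_⟩
    have : lamNeg lam = 0 := max_eq_right (by linarith)
    simp [IsSmall, this, hε.le]
  · obtain ⟨d, hd, hsm⟩ := exists_isSmall (ε := ε) (lam := lam) hε
    exact ⟨min 1 d, lt_min one_pos hd, min_le_left _ _, fun h => absurd h hl,
      hsm.mono hε (lt_min one_pos hd).le (min_le_right _ _)⟩

/-- The constant in the frequency bound. -/
noncomputable def freqConst (ε lam Λ : ℝ) : ℝ := |Λ| + errConst ε lam / (2 * ε + 2)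

theorem freqConst_nonneg (hε : 0 < ε) (lam Λ : ℝ) : 0 ≤ freqConst ε lam Λ := by
  have := errConst_nonneg (lam := lam) hε
  unfold freqConst; positivity

/-- Frequency bound and lower bound of `I`, with explicit constants. -/
theorem frequency_bounds (hn : 2 ≤ n) (hε : 0 < ε) (hN : (n : ℝ) ≤ N) (hη : η ≤ 1)
    (h : IsEigenfunction ε N η lam R u) (hne : ∃ x ∈ ball (0 : E n) R \ {0}, u x ≠ 0)
    {ρ Λ : ℝ} (hρ : ρ ∈ Ioo 0 R) (hρ1 : ρ ≤ 1) (hsm : IsSmall ε lam ρ)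
    (hU : freqU ε N η lam u ρ ≤ Λ) {r : ℝ} (hr : 0 < r) (hrρ : r ≤ ρ) :
    0 < freqI ε N η u r ∧
    freqU ε N η lam u r ≤ freqConst ε lam Λ * r ^ (-2 * ε) ∧
    freqI ε N η u ρ * Real.exp (-((freqConst ε lam Λ / ε + hornExp n ε N η / (2 * ε)) *
      r ^ (-2 * ε))) ≤ freqI ε N η u r := by
  have S := h.radialSystem hn hε hN hη
  have hn1 : 1 ≤ n := by omega
  have hpos : ∀ t ∈ Ioc 0 ρ, 0 < sphJ u t := fun t ht =>
    S.pos_of_ne_zero (sphJ_ne_zero h hne) ⟨ht.1, ht.2.trans_lt hρ.2⟩ (hsm.mono hε ht.1.le ht.2)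
  have hKpos := freqConst_nonneg hε lam Λ
  have hmono : monoFreq ε lam (sphJ u) (sphG u) ρ ≤ freqConst ε lam Λ := by
    have he := errConst_nonneg (lam := lam) hε
    rw [monoFreq, normFreq_eq_mul_freqU hn hε hN hη h hρ, freqConst]
    have h1 : ρ ^ (2 * ε) ≤ 1 := Real.rpow_le_one hρ.1.le hρ1 (by positivity)
    have h2 : ρ ^ (2 * ε + 2) ≤ 1 := Real.rpow_le_one hρ.1.le hρ1 (by positivity)
    have h3 : 0 ≤ ρ ^ (2 * ε) := Real.rpow_nonneg hρ.1.le _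
    gcongr
    · calc ρ ^ (2 * ε) * freqU ε N η lam u ρ ≤ ρ ^ (2 * ε) * |Λ| := by
            gcongr; exact hU.trans (le_abs_self Λ)
        _ ≤ 1 * |Λ| := by gcongr
        _ = |Λ| := one_mul _
    · exact mul_le_of_le_one_right (by positivity) h2
  have hV : ∀ t ∈ Icc r ρ, normFreq ε (sphJ u) (sphG u) t ≤ freqConst ε lam Λ := fun t ht =>
    (S.normFreq_le (hr.trans_le ht.1) ht.2 hρ.2 hsm hpos).trans hmono
  have hJ := S.log_lower_bound hr hrρ hρ.2 hKpos
    (fun t ht => hpos t ⟨hr.trans_le ht.1, ht.2⟩) hV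
  have hβ : 0 ≤ hornExp n ε N η := by
    have h1 : 0 ≤ (N - n) * (1 - η) := mul_nonneg (by linarith) (by linarith)
    have h2 : (1 : ℝ) ≤ n := by exact_mod_cast hn1
    have h3 : 0 ≤ ((n : ℝ) - 1) * ε := mul_nonneg (by linarith) hε.le
    exact add_nonneg h1 h3
  have hK := hornCoef_pos (n := n)
  have hJr := hpos r ⟨hr, hrρ⟩
  have hJρ := hpos ρ ⟨hρ.1, le_rfl⟩
  refine ⟨?_, ?_, ?_⟩
  · rw [freqI_eq hn1 ε N η u hr]
    have := Real.rpow_pos_of_pos hr (hornExp n ε N η)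
    positivity
  · have h1 := hV r ⟨le_rfl, hrρ⟩
    rw [normFreq_eq_mul_freqU hn hε hN hη h ⟨hr, hrρ.trans_lt hρ.2⟩] at h1
    have e : r ^ (-2 * ε) * r ^ (2 * ε) = 1 := by rw [← Real.rpow_add hr]; simp
    calc freqU ε N η lam u r = r ^ (-2 * ε) * (r ^ (2 * ε) * freqU ε N η lam u r) := by
          rw [← mul_assoc, e, one_mul]
      _ ≤ r ^ (-2 * ε) * freqConst ε lam Λ := by gcongr
      _ = _ := mul_comm _ _
  · rw [freqI_eq hn1 ε N η u hr, freqI_eq hn1 ε N η u hρ.1]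
    have h1 := exp_le_rpow hβ hε hr
    have h2 : ρ ^ hornExp n ε N η ≤ 1 := Real.rpow_le_one hρ.1.le hρ1 hβ
    have e : Real.exp (-((freqConst ε lam Λ / ε + hornExp n ε N η / (2 * ε)) * r ^ (-2 * ε))) =
        Real.exp (-(hornExp n ε N η / (2 * ε) * r ^ (-2 * ε))) *
          Real.exp (-(freqConst ε lam Λ / ε * r ^ (-2 * ε))) := by
      rw [← Real.exp_add]; ring_nf
    rw [e]
    calc hornCoef n * ρ ^ hornExp n ε N η * sphJ u ρ *
          (Real.exp (-(hornExp n ε N η / (2 * ε) * r ^ (-2 * ε))) *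
            Real.exp (-(freqConst ε lam Λ / ε * r ^ (-2 * ε))))
        ≤ hornCoef n * 1 * sphJ u ρ * (r ^ hornExp n ε N η *
            Real.exp (-(freqConst ε lam Λ / ε * r ^ (-2 * ε)))) := by gcongr
      _ = hornCoef n * r ^ hornExp n ε N η *
          (sphJ u ρ * Real.exp (-(freqConst ε lam Λ / ε * r ^ (-2 * ε)))) := by ring
      _ ≤ _ := by
          have := Real.rpow_pos_of_pos hr (hornExp n ε N η)
          gcongr

/-- Strong unique continuation at the tip. -/
theorem eq_zero_of_isBigO (hn : 2 ≤ n) (hε : 0 < ε) (hN : (n : ℝ) ≤ N) (hη : η ≤ 1) (hR : 0 < R)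
    (h : IsEigenfunction ε N η lam R u) {C : ℝ} (hC : 0 < C)
    (hO : u =O[𝓝[≠] 0] fun x => Real.exp (-C * ‖x‖ ^ (-2 * ε))) :
    ∀ x ∈ ball (0 : E n) R \ {0}, u x = 0 := by
  have S := h.radialSystem hn hε hN hη
  obtain ⟨c, hc⟩ := hO.bound
  obtain ⟨d, hd, hd'⟩ := Metric.mem_nhdsWithin_iff.1 hc
  obtain ⟨b, hb0, hb⟩ : ∃ b, 0 < b ∧ b < min d R := exists_between (lt_min hd hR)
  have hbR : b ∈ Ioo 0 R := ⟨hb0, hb.trans_le (min_le_right _ _)⟩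
  have hJ : ∀ t ∈ Ioo 0 R, sphJ u t = 0 := by
    refine S.eq_zero_of_decay (M := c ^ 2 * (volume : Measure (E n)).toSphere.real univ)
      (c := 2 * C) hbR (by positivity) fun t ht => ?_
    have htR : t ∈ Ioo 0 R := ⟨ht.1, ht.2.trans_lt hbR.2⟩
    have hpt : ∀ ω : sphere (0 : E n) 1, u (t • (ω : E n)) ^ 2 ≤
        c ^ 2 * Real.exp (-(2 * C) * t ^ (-2 * ε)) := by
      intro ω
      have hmem : t • (ω : E n) ∈ ball (0 : E n) d ∩ {0}ᶜ :=
        ⟨mem_ball_zero_iff.2 (by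
          rw [norm_smul_sphere ht.1]; exact ht.2.trans_lt (hb.trans_le (min_le_left _ _))),
          (smul_sphere_mem htR ω).2⟩
      have h1 : ‖u (t • (ω : E n))‖ ≤
          c * ‖Real.exp (-C * ‖t • (ω : E n)‖ ^ (-2 * ε))‖ := hd' hmem
      rw [norm_smul_sphere ht.1, Real.norm_eq_abs, Real.norm_eq_abs, Real.abs_exp] at h1
      have e : Real.exp (-(2 * C) * t ^ (-2 * ε)) = Real.exp (-C * t ^ (-2 * ε)) ^ 2 := by
        rw [← Real.exp_nat_mul]; congr 1; push_cast; ring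
      rw [e, ← mul_pow, ← sq_abs (u _)]
      exact pow_le_pow_left₀ (abs_nonneg _) h1 2
    calc sphJ u t ≤ ∫ _ω : sphere (0 : E n) 1, c ^ 2 * Real.exp (-(2 * C) * t ^ (-2 * ε))
          ∂(volume : Measure (E n)).toSphere :=
          integral_mono (integrable_sphere_slice (h.cont_u.pow 2) htR) (integrable_const _) hpt
      _ = _ := by rw [integral_const, smul_eq_mul]; ring
  exact fun x hx => eq_zero_of_sphJ_eq_zero h hx
    (hJ _ ⟨norm_pos_iff.2 hx.2, mem_ball_zero_iff.1 hx.1⟩)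

end

end MetricHorn

theorem mainTheorem4 (n : ℕ) (hn : 2 ≤ n) (ε N η lam : ℝ)
    (hε : 0 < ε) (hN : (n : ℝ) ≤ N) (hη : η ≤ 1) :
    -- frequency bound and lower bound of `I`
    (∃ r₀ : ℝ, 0 < r₀ ∧ r₀ ≤ 1 ∧ (0 ≤ lam → r₀ = 1) ∧
      ∀ ρ : ℝ, 0 < ρ → ρ ≤ r₀ → ∀ Λ : ℝ, ∃ C : ℝ, 0 < C ∧
        ∀ R : ℝ, ρ < R → ∀ u : MetricHorn.E n → ℝ,
          MetricHorn.IsEigenfunction ε N η lam R u →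
          (∃ x ∈ Metric.ball (0 : MetricHorn.E n) R \ {0}, u x ≠ 0) →
          MetricHorn.freqU ε N η lam u ρ ≤ Λ →
          ∀ r : ℝ, 0 < r → r ≤ ρ →
            0 < MetricHorn.freqI ε N η u r ∧
            MetricHorn.freqU ε N η lam u r ≤ C * r ^ (-2 * ε) ∧
            C⁻¹ * MetricHorn.freqI ε N η u ρ * Real.exp (-C * r ^ (-2 * ε)) ≤
              MetricHorn.freqI ε N η u r) ∧
    -- strong unique continuation at the tip
    (∀ R : ℝ, 0 < R → ∀ u : MetricHorn.E n → ℝ,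
      MetricHorn.IsEigenfunction ε N η lam R u →
      (∃ C : ℝ, 0 < C ∧ u =O[𝓝[≠] 0] fun x => Real.exp (-C * ‖x‖ ^ (-2 * ε))) →
      ∀ x ∈ Metric.ball (0 : MetricHorn.E n) R \ {0}, u x = 0) := by

  refine ⟨?_, fun R hR u h ⟨C, hC, hO⟩ =>
    MetricHorn.eq_zero_of_isBigO hn hε hN hη hR h hC hO⟩
  obtain ⟨r₀, h0, h1, hl, hsm⟩ := MetricHorn.exists_radius hε lam
  refine ⟨r₀, h0, h1, hl, fun ρ hρ hρr Λ => ?_⟩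
  have hK := MetricHorn.freqConst_nonneg hε lam Λ
  have hβ : 0 ≤ |MetricHorn.hornExp n ε N η| / (2 * ε) := by positivity
  have hKε : 0 ≤ MetricHorn.freqConst ε lam Λ / ε := by positivity
  set C := 1 + MetricHorn.freqConst ε lam Λ + MetricHorn.freqConst ε lam Λ / ε +
    |MetricHorn.hornExp n ε N η| / (2 * ε) with hC
  refine ⟨C, by positivity, fun R hR u h hne hU r hr hrρ => ?_⟩
  obtain ⟨b1, b2, b3⟩ := MetricHorn.frequency_bounds hn hε hN hη h hne ⟨hρ, hR⟩ (hρr.trans h1)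
    (hsm.mono hε hρ.le hρr) hU hr hrρ
  have hp : 0 ≤ r ^ (-2 * ε) := Real.rpow_nonneg hr.le _
  refine ⟨b1, b2.trans ?_, le_trans ?_ b3⟩
  · gcongr
    linarith
  · have hIρ := (MetricHorn.frequency_bounds hn hε hN hη h hne ⟨hρ, hR⟩ (hρr.trans h1)
      (hsm.mono hε hρ.le hρr) hU hρ le_rfl).1
    have hC1 : C⁻¹ ≤ 1 := inv_le_one_of_one_le₀ (by linarith)
    have hexp : MetricHorn.freqConst ε lam Λ / ε + MetricHorn.hornExp n ε N η / (2 * ε) ≤ C := by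
      have : MetricHorn.hornExp n ε N η / (2 * ε) ≤ |MetricHorn.hornExp n ε N η| / (2 * ε) := by
        gcongr
        exact le_abs_self _
      linarith
    calc C⁻¹ * MetricHorn.freqI ε N η u ρ * Real.exp (-C * r ^ (-2 * ε))
        ≤ 1 * MetricHorn.freqI ε N η u ρ * Real.exp (-((MetricHorn.freqConst ε lam Λ / ε +
          MetricHorn.hornExp n ε N η / (2 * ε)) * r ^ (-2 * ε))) := by
          gcongr
          rw [neg_mul]
          gcongr
      _ = _ := by rw [one_mul]
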